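/- Let $p$ be a probability distribution on $\{0,1,2,\dots\}$ with $\sum_k k\,p(k)=1$, $\sum_k k(k-1)p(k)\in(0,\infty)$ and $\sum_k k^3p(k)<\infty$, and let $\widetilde p(k)=(k+1)p(k+1)$ for $k\ge 0$. Let $\mathbf p^1(x,y)=\mathbf p^1(o,y-x)$ be the transition probability of a random walk on $\mathbb Z^d$ such that $\sum_x e^{b|x|}\mathbf p^1(o,x)<\infty$ for some $b>0$, the set $\{x:\mathbf p^1(o,x)>0\}$ generates $\mathbb Z^d$ as a group, and $\mathbf p^1(x,y)=\mathbf p^1(y,x)$. Write $\mathbf p^n$ for its $n$-step transition probabilities. For $n\ge 1$ and $m\ge 2n$ let $\mathcal T_{n,m}$ be the random tree consisting of a backbone $V_0,\dots,V_n$ with root $V_0$ and, independently for each $0\le j\le n$, a critical tree $\mathcal T_{n,m}(j)$ attached at $V_j$, in which $V_j$ has offspring distribution $\widetilde p$ and all later vertices have offspring distribution $p$, conditioned not to reach level $m$ (levels are counted from $V_0$). Let $\Phi$ map the vertices of $\mathcal T_{n,m}$ to $\mathbb Z^d\times\mathbb Z_+$ by $\Phi(V_0)=(o,0)$ and, recursively,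 for every edge $\{U,V\}$ between levels $k$ and $k+1$ with $\Phi(U)=(u,k)$, by $\Phi(V)=(v,k+1)$ with $v-u$ distributed according to $\mathbf p^1(o,\cdot)$, independently for different edges. The trace is the multigraph with vertex set $\Phi(\mathcal T_{n,m})$ and one edge $\{\Phi(U),\Phi(V)\}$ for every edge $\{U,V\}$ of $\mathcal T_{n,m}$, and $R_{\mathrm{eff}}(a\leftrightarrow b)$ denotes the effective resistance between $a$ and $b$ in the trace when every edge has unit resistance. (If $n=1$, $m=2$ and $p(1)=0$, the event conditioned on is null; expectations under $\mathcal T_{1,2}$ are then read as $0$.) Put $$\gamma(k,y)=\sup_{m'\ge 2k}\mathbf E_{\mathcal T_{k,m'}}\big[R_{\mathrm{eff}}((o,0)\leftrightarrow\Phi(V_k))\,\big|\,\Phi(V_k)=(y,k)\big],$$ $$\bar\gamma(k;(x,n))=\sum_{y\in\mathbb Z^d}\frac{\mathbf p^k(o,y)\,\mathbf p^{n-k}(y,x)}{\mathbf p^n(o,x)}\,\gamma(k,y)\qquad(k\le n),$$ where terms with $\mathbf p^k(o,y)=0$ are $0$. **Lemma.** Let $n\ge 1$, $m\ge 2n$,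 let $\delta>0$ be such that $\delta n$ is an integer, and put $X_j=V_{j\delta n}$ for $0\le j\le\lfloor\delta^{-1}\rfloor$. Let $K\ge 1$ and $i\ge 0$ be integers with $i+K\le\lfloor\delta^{-1}\rfloor$, and let $x\in\mathbb Z^d$ satisfy $\mathbf p^n(o,x)>0$. Let $\mathcal E_{(1)}$ be the event that the following condition fails: there is a unique $\ell_1$ with $i\delta n\le\ell_1<(i+1)\delta n$ such that $\mathcal T_{n,m}(\ell_1)$ reaches level $(i+2)\delta n$, and this $\ell_1$ satisfies $(i+\tfrac14)\delta n\le\ell_1\le(i+\tfrac34)\delta n$. Then, under $\mathcal T_{n,m}$, $$\mathbf E\big[R_{\mathrm{eff}}(\Phi(X_i)\leftrightarrow\Phi(X_{i+K}))\,\big|\,\mathcal E_{(1)},\,\Phi(V_n)=(x,n)\big]\le K\,\bar\gamma(\delta n;(x,n)).$$ -/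

import Mathlib

open MeasureTheory ProbabilityTheory
open scoped ENNReal

noncomputable section

namespace BranchingWalk

/-- The lattice `ℤ^d`. -/
abbrev Site (d : ℕ) : Type := Fin d → ℤ

/-- The Euclidean length of a lattice point. -/
def euclid {d : ℕ} (x : Site d) : ℝ := Real.sqrt (∑ i, (x i : ℝ) ^ 2)

/-- The assumptions on the progeny distribution: mean one, `∑ k (k - 1) p k ∈ (0, ∞)`,
and a finite third moment. -/
structure ProgenyAssumptions (p : PMF ℕ) : Prop where
  mean_one : ∑' k : ℕ, (k : ℝ≥0∞) * p k = 1
  variance_pos : 0 < ∑' k : ℕ, ((k * (k - 1) : ℕ) : ℝ≥0∞) * p k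
  variance_finite : ∑' k : ℕ, ((k * (k - 1) : ℕ) : ℝ≥0∞) * p k < ∞
  third_moment : ∑' k : ℕ, (k : ℝ≥0∞) ^ 3 * p k < ∞

/-- The assumptions on the step distribution `P z = 𝐩¹(o, z)`: an exponential moment,
the support generates `ℤ^d` as a group, and symmetry. -/
structure StepAssumptions {d : ℕ} (P : PMF (Site d)) : Prop where
  exp_moment : ∃ b : ℝ, 0 < b ∧
    ∑' x : Site d, ENNReal.ofReal (Real.exp (b * euclid x)) * P x < ∞
  generates : AddSubgroup.closure {x : Site d | 0 < P x} = ⊤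
  symmetric : ∀ x : Site d, P (-x) = P x

/-- The `n`-step transition probability `𝐩ⁿ(x, y)` of the walk with step distribution `P`. -/
def nStep {d : ℕ} (P : PMF (Site d)) : ℕ → Site d → Site d → ℝ≥0∞
  | 0, x, y => if x = y then 1 else 0
  | n + 1, x, y => ∑' z : Site d, P (z - x) * nStep P n z y

/-- Finite rooted plane trees with a displacement in `ℤ^d` on every edge: the root has `k`
children, `step i` is the displacement along the edge to the `i`-th child, and `child i` is the
subtree of its descendants. -/
inductive SpTree (d : ℕ) : Type
  | node (k : ℕ) (step : Fin k → Site d) (child : Fin k → SpTree d) : SpTree d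

instance {d : ℕ} : MeasurableSpace (SpTree d) := ⊤

namespace SpTree

/-- The height of a tree: the largest generation that is not empty. -/
def height {d : ℕ} : SpTree d → ℕ
  | node _ _ child => Finset.univ.sup fun i => (child i).height + 1

/-- The probability of a given finite tree with displacements when offspring numbers are
independent with law `p` and displacements are independent with law `P`. -/
def weight {d : ℕ} (p : PMF ℕ) (P : PMF (Site d)) : SpTree d → ℝ≥0∞
  | node k step child => p k * ∏ i, (P (step i) * (child i).weight p P)

/-- The same with offspring law `p̃ k = (k + 1) p (k + 1)` at the root, and `p` afterwards. -/
def rootWeight {d : ℕ} (p : PMF ℕ) (P : PMF (Site d)) : SpTree d → ℝ≥0∞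
  | node k step child =>
      (((k + 1 : ℕ) : ℝ≥0∞) * p (k + 1)) * ∏ i, (P (step i) * (child i).weight p P)

/-- The images in space-time of the edges of a tree whose root is mapped to `(x, h)`,
with multiplicity. -/
def trace {d : ℕ} : SpTree d → Site d → ℕ → Multiset (Sym2 (Site d × ℕ))
  | node _ step child, x, h =>
      ∑ i, ({s((x, h), (x + step i, h + 1))} + (child i).trace (x + step i) (h + 1))

end SpTree

/-- The law of the critical branching random walk with offspring law `p̃` at the root and `p`
afterwards. The critical tree is almost surely finite, hence the law lives on finite trees. -/
def treeLaw {d : ℕ} (p : PMF ℕ) (P : PMF (Site d)) : Measure (SpTree d) :=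
  Measure.count.withDensity (SpTree.rootWeight p P)

/-- A realisation of `𝒯_{n,m}` together with the random walk map: the displacements along the
backbone `V_0, …, V_n`, and the tree attached at each `V_j`. -/
abbrev Sample (d n : ℕ) : Type := (Fin n → Site d) × (Fin (n + 1) → SpTree d)

/-- The law of `𝒯_{n,m}` together with the random walk map: independent backbone displacements
with law `P`, and independently for each `0 ≤ j ≤ n` a critical tree attached at `V_j` that is
conditioned to die out by time `m - j`, that is, not to reach level `m`. -/
def law {d : ℕ} (p : PMF ℕ) (P : PMF (Site d)) (n m : ℕ) : Measure (Sample d n) :=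
  (Measure.pi fun _ : Fin n => P.toMeasure).prod
    (Measure.pi fun j : Fin (n + 1) =>
      ProbabilityTheory.cond (treeLaw p P) {t : SpTree d | (j : ℕ) + t.height < m})

namespace Sample

/-- The spatial location of the backbone vertex `V_j`. -/
def pos {d n : ℕ} (ω : Sample d n) (j : ℕ) : Site d :=
  ∑ r : Fin n, if (r : ℕ) < j then ω.1 r else 0

/-- The space-time location `Φ(V_j)`. -/
def Phi {d n : ℕ} (ω : Sample d n) (j : ℕ) : Site d × ℕ := (ω.pos j, j)

/-- The trace: the multigraph of the images of all edges, on the backbone and off it. -/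
def trace {d n : ℕ} (ω : Sample d n) : Multiset (Sym2 (Site d × ℕ)) :=
  (∑ r : Fin n, {s(ω.Phi (r : ℕ), ω.Phi ((r : ℕ) + 1))}) +
    ∑ j : Fin (n + 1), (ω.2 j).trace (ω.pos j) j

/-- The tree attached at `V_ℓ` reaches level `H`, where levels are counted from the root `V_0`. -/
def Reaches {d n : ℕ} (ω : Sample d n) (ℓ : Fin (n + 1)) (H : ℕ) : Prop :=
  H ≤ (ℓ : ℕ) + (ω.2 ℓ).height

/-- `V_ℓ` is in the `i`-th backbone segment of length `L` and the tree attached at it reaches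
level `(i + 2) L`. -/
def LongBranch {d n : ℕ} (ω : Sample d n) (L i : ℕ) (ℓ : Fin (n + 1)) : Prop :=
  i * L ≤ (ℓ : ℕ) ∧ (ℓ : ℕ) < (i + 1) * L ∧ ω.Reaches ℓ ((i + 2) * L)

/-- The first condition of tree-goodness (with `L = δ n`): the segment has exactly one such vertex
`V_ℓ`, and `(i + 1/4) L ≤ ℓ ≤ (i + 3/4) L`. -/
def CondOne {d n : ℕ} (ω : Sample d n) (L i : ℕ) : Prop :=
  ∃ ℓ : Fin (n + 1), ω.LongBranch L i ℓ ∧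
    (∀ ℓ' : Fin (n + 1), ω.LongBranch L i ℓ' → ℓ' = ℓ) ∧
    ((i : ℝ) + 1 / 4) * L ≤ ((ℓ : ℕ) : ℝ) ∧ ((ℓ : ℕ) : ℝ) ≤ ((i : ℝ) + 3 / 4) * L

end Sample

/-- The event that `V_n` is mapped to `(x, n)`. -/
def endpoint {d : ℕ} (n : ℕ) (x : Site d) : Set (Sample d n) := {ω | ω.Phi n = (x, n)}

/-- The event that the first condition of tree-goodness fails. -/
def failOne (d n L i : ℕ) : Set (Sample d n) := {ω | ¬ ω.CondOne L i}

/-- The squared difference of a potential across an edge. -/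
def edgeEnergy {V : Type} (f : V → ℝ) : Sym2 V → ℝ :=
  Sym2.lift ⟨fun u v => (f u - f v) ^ 2, fun u v => by ring⟩

/-- The Dirichlet energy of a potential on a finite multigraph with unit resistances. -/
def energy {V : Type} (E : Multiset (Sym2 V)) (f : V → ℝ) : ℝ := (E.map (edgeEnergy f)).sum

/-- The effective conductance: the least energy of a potential with values `1` at `a`
and `0` at `b`. -/
def effCond {V : Type} (E : Multiset (Sym2 V)) (a b : V) : ℝ≥0∞ :=
  ⨅ (f : V → ℝ) (_ : f a = 1 ∧ f b = 0), ENNReal.ofReal (energy E f)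

/-- The effective resistance; it is `0` if `a = b`, and `∞` if `a` and `b` are not connected. -/
def effRes {V : Type} (E : Multiset (Sym2 V)) (a b : V) : ℝ≥0∞ := (effCond E a b)⁻¹

/-- `γ(n, x)`: the supremum over `m ≥ 2 n` of the expectation under `𝒯_{n,m}` of the effective
resistance between `(o, 0)` and `Φ(V_n)`, given `Φ(V_n) = (x, n)`. -/
def gamma {d : ℕ} (p : PMF ℕ) (P : PMF (Site d)) (n : ℕ) (x : Site d) : ℝ≥0∞ :=
  ⨆ (m : ℕ) (_ : 2 * n ≤ m),
    ∫⁻ ω, effRes ω.trace ((0 : Site d), 0) (ω.Phi n)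
      ∂(ProbabilityTheory.cond (law p P n m) (endpoint n x))

/-- `γ̄(k; (x, n))`, for `k ≤ n`. -/
def gammaBar {d : ℕ} (p : PMF ℕ) (P : PMF (Site d)) (k : ℕ) (x : Site d) (n : ℕ) : ℝ≥0∞ :=
  ∑' y : Site d, nStep P k 0 y * nStep P (n - k) y x / nStep P n 0 x * gamma p P k y

end BranchingWalk

end

/-! The triangle inequality for effective resistance cuts the backbone into `K` blocks of length `L
= δ n`, and each block must contribute at most `γ̄`. For one block, Rayleigh monotonicity discards
every edge outside its backbone and its `L + 1` attached trees, and a translation moves it to the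
origin. The endpoint constrains only the displacements and the failure event only the attached
trees, so the two factorize. Given the endpoint, the displacements of a block form a random walk
bridge (`lintegral_block`); this produces the average over `y` in `γ̄`.

It remains to see, for fixed displacements, that the failure does not raise the mean resistance
above that for some `𝒯_{L,m'}` with `m' ≥ 2 L`. For a block `j > i` the failure concerns trees
outside the block, and independence gives `m' = m - j L`. For `j = i` the failure is a function of
which trees of the block reach level `(i + 2) L`. Resistance decreases when a tree grows, and
conditioning a tree to stay below that level makes it stochastically smaller. So whatever the
pattern of long branches, the mean resistance is at most the one with all trees of the block
conditioned to stay low, which is `m' = 2 L` (`lintegral_failTrees_of_self`).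

The stochastic comparison `lintegral_lowTrees_mul_le` goes by induction on the height. Under the
conditioning, the subtrees of the root are independent low trees, and the offspring weights are
multiplied by `q ^ k`, where `q` is the probability that a subtree is low. A smaller `q` favours
fewer children, and Chebyshev's association inequality `tsum_mul_tsum_le` concludes. -/

namespace BranchingWalk

/-! ### Effective resistance: monotonicity, contraction and the triangle inequality -/

section Resistance

variable {V W : Type}

lemma edgeEnergy_mk (f : V → ℝ) (u v : V) : edgeEnergy f s(u, v) = (f u - f v) ^ 2 := rfl

lemma edgeEnergy_nonneg (f : V → ℝ) (e : Sym2 V) : 0 ≤ edgeEnergy f e := by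
  induction e using Sym2.ind with
  | _ u v => exact sq_nonneg _

lemma energy_nonneg (E : Multiset (Sym2 V)) (f : V → ℝ) : 0 ≤ energy E f := by
  refine Multiset.sum_nonneg fun x hx => ?_
  obtain ⟨e, -, rfl⟩ := Multiset.mem_map.1 hx
  exact edgeEnergy_nonneg f e

lemma energy_add (E F : Multiset (Sym2 V)) (f : V → ℝ) :
    energy (E + F) f = energy E f + energy F f := by
  simp [energy]

lemma energy_mono {E F : Multiset (Sym2 V)} (h : E ≤ F) (f : V → ℝ) :
    energy E f ≤ energy F f := by
  obtain ⟨D, rfl⟩ := Multiset.le_iff_exists_add.1 h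
  rw [energy_add]
  linarith [energy_nonneg D f]

/-- Rayleigh monotonicity. -/
lemma effRes_anti {E F : Multiset (Sym2 V)} (h : E ≤ F) (a b : V) :
    effRes F a b ≤ effRes E a b := by
  refine ENNReal.inv_le_inv.2 (iInf₂_mono fun f _ => ENNReal.ofReal_le_ofReal (energy_mono h f))

lemma energy_map (φ : V → W) (E : Multiset (Sym2 V)) (f : W → ℝ) :
    energy (E.map (Sym2.map φ)) f = energy E (f ∘ φ) := by
  unfold energy
  rw [Multiset.map_map]
  congr 1
  refine Multiset.map_congr rfl fun e _ => ?_
  induction e using Sym2.ind with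
  | _ u v => rfl

/-- Mapping a network, possibly identifying vertices, does not increase resistances. -/
lemma effRes_map_le (φ : V → W) (E : Multiset (Sym2 V)) (a b : V) :
    effRes (E.map (Sym2.map φ)) (φ a) (φ b) ≤ effRes E a b := by
  refine ENNReal.inv_le_inv.2 (le_iInf₂ fun f hf => ?_)
  rw [energy_map]
  exact iInf₂_le (f ∘ φ) hf

lemma energy_affine (E : Multiset (Sym2 V)) (f : V → ℝ) (c s : ℝ) :
    energy E (fun v => c * (f v - s)) = c ^ 2 * energy E f := by
  unfold energy
  rw [← Multiset.sum_map_mul_left]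
  congr 1
  refine Multiset.map_congr rfl fun e _ => ?_
  induction e using Sym2.ind with
  | _ u v => simp only [edgeEnergy_mk]; ring

lemma sq_mul_effCond_le (E : Multiset (Sym2 V)) (f : V → ℝ) (a b : V) :
    ENNReal.ofReal ((f a - f b) ^ 2) * effCond E a b ≤ ENNReal.ofReal (energy E f) := by
  by_cases h : f a - f b = 0
  · simp [h]
  · have h1 : effCond E a b ≤
        ENNReal.ofReal (energy E (fun v => (f a - f b)⁻¹ * (f v - f b))) :=
      iInf₂_le _ ⟨by simp [h], by simp⟩
    rw [energy_affine] at h1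
    calc _ ≤ ENNReal.ofReal ((f a - f b) ^ 2) *
          ENNReal.ofReal ((f a - f b)⁻¹ ^ 2 * energy E f) := by gcongr
      _ = ENNReal.ofReal (energy E f) := by
        rw [← ENNReal.ofReal_mul (sq_nonneg _)]
        congr 1
        field_simp

/-- On each edge the increments of the two truncations have the same sign and add up to the
increment of `f`, so their squares add up to at most its square. -/
lemma energy_truncate (E : Multiset (Sym2 V)) (f : V → ℝ) (t : ℝ) :
    energy E (fun v => max (f v) t) + energy E (fun v => min (f v) t) ≤ energy E f := by
  unfold energy
  rw [← Multiset.sum_map_add]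
  refine Multiset.sum_map_le_sum_map _ _ fun e _ => ?_
  induction e using Sym2.ind with
  | _ u v =>
    simp only [edgeEnergy_mk]
    rcases le_total (f u) t with h1 | h1 <;> rcases le_total (f v) t with h2 | h2 <;>
      simp only [h1, h2, max_eq_left, max_eq_right, min_eq_left, min_eq_right] <;>
      nlinarith [mul_nonneg (sub_nonneg.2 h1) (sub_nonneg.2 h2)]

/-- The series law: the left side is the minimum of the right side over splittings of a unit
potential drop into `s` and `t`. -/
lemma inv_add_inv_le (α β : ℝ≥0∞) {s t : ℝ} (hs : 0 ≤ s) (ht : 0 ≤ t) (hst : s + t = 1) :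
    (α⁻¹ + β⁻¹)⁻¹ ≤ ENNReal.ofReal (s ^ 2) * α + ENNReal.ofReal (t ^ 2) * β := by
  by_cases hα0 : α = 0
  · simp [hα0]
  by_cases hβ0 : β = 0
  · simp [hβ0]
  by_cases hα : α = ∞
  · rcases hs.eq_or_lt with rfl | hs'
    · obtain rfl : t = 1 := by linarith
      simp [hα]
    · have : ENNReal.ofReal (s ^ 2) ≠ 0 := by
        simpa using hs'.ne'
      simp [hα, ENNReal.mul_top this]
  by_cases hβ : β = ∞
  · rcases ht.eq_or_lt with rfl | hs'
    · obtain rfl : s = 1 := by linarith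
      simp [hβ]
    · have : ENNReal.ofReal (t ^ 2) ≠ 0 := by
        simpa using hs'.ne'
      simp [hβ, ENNReal.mul_top this]
  have ha := ENNReal.toReal_pos hα0 hα
  have hb := ENNReal.toReal_pos hβ0 hβ
  rw [← ENNReal.ofReal_toReal hα, ← ENNReal.ofReal_toReal hβ]
  set a := α.toReal
  set b := β.toReal
  rw [← ENNReal.ofReal_inv_of_pos ha, ← ENNReal.ofReal_inv_of_pos hb,
    ← ENNReal.ofReal_add (by positivity) (by positivity),
    ← ENNReal.ofReal_inv_of_pos (by positivity), ← ENNReal.ofReal_mul (by positivity),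
    ← ENNReal.ofReal_mul (by positivity), ← ENNReal.ofReal_add (by positivity) (by positivity)]
  refine ENNReal.ofReal_le_ofReal ?_
  obtain rfl : t = 1 - s := by linarith
  have : (a⁻¹ + b⁻¹)⁻¹ = a * b / (a + b) := by field_simp; ring
  rw [this, div_le_iff₀ (by positivity)]
  nlinarith [sq_nonneg (s * a - (1 - s) * b)]

/-- The triangle inequality for effective resistances. -/
lemma effRes_triangle (E : Multiset (Sym2 V)) (a b c : V) :
    effRes E a c ≤ effRes E a b + effRes E b c := by
  unfold effRes
  rw [ENNReal.inv_le_iff_inv_le]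
  refine le_iInf₂ fun f hf => ?_
  obtain ⟨ha, hc⟩ := hf
  have hab := sq_mul_effCond_le E f a b
  have hbc := sq_mul_effCond_le E f b c
  have one_le : ∀ {r : ℝ}, 1 ≤ r → ∀ α : ℝ≥0∞, α ≤ ENNReal.ofReal (r ^ 2) * α := by
    intro r hr α
    refine le_mul_of_one_le_left' ?_
    rw [ENNReal.one_le_ofReal]
    nlinarith
  -- If `f b` lies outside `[0, 1]`, the drop across one of the two pairs is already at least `1`.
  -- Otherwise `f` is cut at height `f b`, and the two truncations carry the drops `1 - f b` and `f
  -- b`.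
  rcases le_total (f b) 0 with hb | hb
  · calc _ ≤ effCond E a b := ENNReal.inv_le_iff_inv_le.1 le_self_add
      _ ≤ _ := (one_le (by linarith) _).trans hab
  rcases le_total 1 (f b) with hb' | hb'
  · calc _ ≤ effCond E b c := ENNReal.inv_le_iff_inv_le.1 le_add_self
      _ ≤ _ := (one_le (by linarith) _).trans hbc
  refine (inv_add_inv_le _ _ (sub_nonneg.2 hb') hb (by ring)).trans ?_
  have h1 := sq_mul_effCond_le E (fun v => max (f v) (f b)) a b
  have h2 := sq_mul_effCond_le E (fun v => min (f v) (f b)) b c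
  simp only [ha, hc, hb, hb', max_self, min_self, max_eq_left, min_eq_left, sub_zero] at h1 h2
  refine (add_le_add h1 h2).trans ?_
  rw [← ENNReal.ofReal_add (energy_nonneg _ _) (energy_nonneg _ _)]
  exact ENNReal.ofReal_le_ofReal (energy_truncate E f (f b))

/-- No potential is admissible, so the conductance is an empty infimum. -/
lemma effRes_self (E : Multiset (Sym2 V)) (a : V) : effRes E a a = 0 := by
  unfold effRes effCond
  rw [ENNReal.inv_eq_zero, iInf₂_eq_top]
  rintro f ⟨h1, h2⟩
  exact absurd (h1.symm.trans h2) one_ne_zero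

lemma effRes_le_sum (E : Multiset (Sym2 V)) (v : ℕ → V) (K : ℕ) :
    effRes E (v 0) (v K) ≤ ∑ j ∈ Finset.range K, effRes E (v j) (v (j + 1)) := by
  induction K with
  | zero => simp [effRes_self]
  | succ K ih =>
    rw [Finset.sum_range_succ]
    exact (effRes_triangle E _ (v K) _).trans (by gcongr)

end Resistance

/-! ### Trees, pruning, and blocks of the backbone -/

section Trees

variable {d : ℕ}

namespace SpTree

/-- A tree is given by the number of children of the root, and by the displacements and the
subtrees of the children. -/
def equivSigma (d : ℕ) :
    SpTree d ≃ Σ k : ℕ, (Fin k → Site d) × (Fin k → SpTree d) where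
  toFun | node k s c => ⟨k, s, c⟩
  invFun x := node x.1 x.2.1 x.2.2
  left_inv := by rintro ⟨k, s, c⟩; rfl
  right_inv := by rintro ⟨k, s, c⟩; rfl

lemma height_node_lt {k h : ℕ} {s : Fin k → Site d} {c : Fin k → SpTree d} :
    (node k s c).height < h + 1 ↔ ∀ i, (c i).height < h := by
  rw [height, Finset.sup_lt_iff (by simp)]
  simp

lemma countable_height_lt (h : ℕ) : {t : SpTree d | t.height < h}.Countable := by
  induction h with
  | zero => simp
  | succ h ih =>
    have := ih.to_subtype
    refine Set.Countable.mono ?_ (Set.countable_range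
      (fun x : Σ k : ℕ, (Fin k → Site d) × (Fin k → {t : SpTree d | t.height < h}) =>
        node x.1 x.2.1 fun i => (x.2.2 i : SpTree d)))
    rintro ⟨k, s, c⟩ ht
    exact ⟨⟨k, s, fun i => ⟨c i, height_node_lt.1 ht i⟩⟩, rfl⟩

instance : Countable (SpTree d) := by
  rw [← Set.countable_univ_iff]
  refine (Set.countable_iUnion fun h => countable_height_lt (d := d) h).mono fun t _ => ?_
  exact Set.mem_iUnion.2 ⟨t.height + 1, Nat.lt_succ_self _⟩

instance : Nonempty (SpTree d) := ⟨node 0 Fin.elim0 Fin.elim0⟩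

/-- `Prunes t t'`: the tree `t` arises from `t'` by pruning, at every vertex, some of the last
children together with their descendants. -/
inductive Prunes : SpTree d → SpTree d → Prop
  | node {k k' : ℕ} (hk : k ≤ k') (s : Fin k → Site d) (s' : Fin k' → Site d)
      (c : Fin k → SpTree d) (c' : Fin k' → SpTree d)
      (hs : ∀ i, s' (Fin.castLE hk i) = s i) (hc : ∀ i, Prunes (c i) (c' (Fin.castLE hk i))) :
      Prunes (node k s c) (node k' s' c')

lemma Prunes.refl (t : SpTree d) : Prunes t t := by
  induction t with
  | node k s c ih => exact Prunes.node le_rfl s s c c (fun _ => rfl) ih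

lemma Prunes.leaf (s : Fin 0 → Site d) (c : Fin 0 → SpTree d) (t : SpTree d) :
    Prunes (SpTree.node 0 s c) t := by
  cases t with
  | node k s' c' => exact Prunes.node (Nat.zero_le _) _ _ _ _ (fun i => i.elim0) fun i => i.elim0

lemma sum_comp_embedding_le {ι κ M : Type*} [Fintype ι] [Fintype κ] (e : ι ↪ κ)
    (g : κ → Multiset M) : ∑ i, g (e i) ≤ ∑ j, g j := by
  rw [← Finset.sum_map Finset.univ e g]
  exact Finset.sum_le_sum_of_subset (Finset.subset_univ _)

lemma Prunes.trace_le {t t' : SpTree d} (h : Prunes t t') (x : Site d) (l : ℕ) :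
    t.trace x l ≤ t'.trace x l := by
  induction h generalizing x l with
  | @node k k' hk s s' c c' hs hc ih =>
    have h1 : ∀ i : Fin k, ({s((x, l), (x + s i, l + 1))} + (c i).trace (x + s i) (l + 1) :
          Multiset (Sym2 (Site d × ℕ))) ≤
        {s((x, l), (x + s' (Fin.castLE hk i), l + 1))} +
          (c' (Fin.castLE hk i)).trace (x + s' (Fin.castLE hk i)) (l + 1) := by
      intro i
      rw [hs i]
      exact add_le_add le_rfl (ih i _ _)
    rw [SpTree.trace, SpTree.trace]
    refine (Finset.sum_le_sum fun i _ => h1 i).trans ?_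
    exact sum_comp_embedding_le (Fin.castLEEmb hk) fun i =>
      ({s((x, l), (x + s' i, l + 1))} + (c' i).trace (x + s' i) (l + 1) :
        Multiset (Sym2 (Site d × ℕ)))

end SpTree

/-- Translation in space-time. -/
def shift (z : Site d) (l : ℕ) (v : Site d × ℕ) : Site d × ℕ := (z + v.1, l + v.2)

lemma SpTree.map_trace (t : SpTree d) (z x : Site d) (l h : ℕ) :
    (t.trace x h).map (Sym2.map (shift z l)) = t.trace (z + x) (l + h) := by
  induction t generalizing x h with
  | node k s c ih =>
    rw [SpTree.trace, SpTree.trace, ← Multiset.coe_mapAddMonoidHom, map_sum]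
    refine Finset.sum_congr rfl fun i _ => ?_
    rw [map_add, Multiset.coe_mapAddMonoidHom, ih]
    simp [shift, add_assoc]

namespace Sample

variable {n : ℕ}

/-- The part of a sample between the levels `l` and `l + L` of the backbone. -/
def segment (ω : Sample d n) (l L : ℕ) (h : l + L ≤ n) : Sample d L :=
  (fun r => ω.1 ⟨l + r, by omega⟩, fun r => ω.2 ⟨l + r, by omega⟩)

lemma pos_segment (ω : Sample d n) {l L : ℕ} (h : l + L ≤ n) {r : ℕ} (hr : r ≤ L) :
    ω.pos l + (ω.segment l L h).pos r = ω.pos (l + r) := by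
  have key : ∀ j, j ≤ n → ω.pos j = ∑ s ∈ Finset.range j, if hs : s < n then ω.1 ⟨s, hs⟩ else 0 := by
    intro j hj
    rw [pos, Finset.sum_fin_eq_sum_range, ← Finset.sum_subset (Finset.range_mono hj)]
    · refine Finset.sum_congr rfl fun s hs => ?_
      simp [Finset.mem_range.1 hs]
    · intro s _ hs
      simp only [Finset.mem_range] at hs
      simp [hs]
  have key2 : (ω.segment l L h).pos r =
      ∑ s ∈ Finset.range r, if hs : l + s < n then ω.1 ⟨l + s, hs⟩ else 0 := by
    rw [pos, Finset.sum_fin_eq_sum_range, ← Finset.sum_subset (Finset.range_mono hr)]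
    · refine Finset.sum_congr rfl fun s hs => ?_
      have hs := Finset.mem_range.1 hs
      simp [segment, hs, hs.trans_le hr, show l + s < n by omega]
    · intro s _ hs
      simp only [Finset.mem_range] at hs
      simp [hs]
  rw [key _ (by omega), key _ (by omega), key2, Finset.sum_range_add]

lemma shift_Phi_segment (ω : Sample d n) {l L : ℕ} (h : l + L ≤ n) {r : ℕ} (hr : r ≤ L) :
    shift (ω.pos l) l ((ω.segment l L h).Phi r) = ω.Phi (l + r) := by
  rw [Phi, shift, pos_segment ω h hr, Phi]

/-- The trace counts edges with multiplicity, so edges from outside the block can only add to it.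
The trees at both ends belong to the block, as they do in `𝒯_{L,m'}`. -/
lemma map_trace_segment_le (ω : Sample d n) {l L : ℕ} (h : l + L ≤ n) :
    (ω.segment l L h).trace.map (Sym2.map (shift (ω.pos l) l)) ≤ ω.trace := by
  rw [trace, trace, Multiset.map_add]
  refine add_le_add ?_ ?_
  · have h1 : (∑ r : Fin L, {s((ω.segment l L h).Phi (r : ℕ),
          (ω.segment l L h).Phi ((r : ℕ) + 1))} : Multiset _).map (Sym2.map (shift (ω.pos l) l)) =
        ∑ r : Fin L, {s(ω.Phi (Fin.castLE h (Fin.natAdd l r) : Fin n),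
          ω.Phi ((Fin.castLE h (Fin.natAdd l r) : Fin n) + 1))} := by
      rw [← Multiset.coe_mapAddMonoidHom, map_sum]
      refine Finset.sum_congr rfl fun r _ => ?_
      simp only [Multiset.coe_mapAddMonoidHom, Multiset.map_singleton, Sym2.map_mk]
      rw [shift_Phi_segment ω h r.2.le, shift_Phi_segment ω h r.2]
      rfl
    rw [h1]
    exact SpTree.sum_comp_embedding_le ((Fin.natAddEmb l).trans (Fin.castLEEmb h))
      fun r : Fin n => ({s(ω.Phi (r : ℕ), ω.Phi ((r : ℕ) + 1))} : Multiset (Sym2 (Site d × ℕ)))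
  · have h' : l + (L + 1) ≤ n + 1 := by omega
    have h1 : (∑ j : Fin (L + 1), ((ω.segment l L h).2 j).trace ((ω.segment l L h).pos j) j).map
          (Sym2.map (shift (ω.pos l) l)) =
        ∑ j : Fin (L + 1), (ω.2 (Fin.castLE h' (Fin.natAdd l j))).trace
          (ω.pos (Fin.castLE h' (Fin.natAdd l j) : Fin (n + 1)))
          (Fin.castLE h' (Fin.natAdd l j) : Fin (n + 1)) := by
      rw [← Multiset.coe_mapAddMonoidHom, map_sum]
      refine Finset.sum_congr rfl fun r _ => ?_
      rw [Multiset.coe_mapAddMonoidHom, SpTree.map_trace,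
        pos_segment ω h (Nat.lt_succ_iff.1 r.2)]
      rfl
    rw [h1]
    exact SpTree.sum_comp_embedding_le ((Fin.natAddEmb l).trans (Fin.castLEEmb h'))
      fun j : Fin (n + 1) => (ω.2 j).trace (ω.pos j) j

/-- The resistance between the two ends of the backbone. -/
noncomputable def endRes (ω : Sample d n) : ℝ≥0∞ := effRes ω.trace ((0 : Site d), 0) (ω.Phi n)

lemma effRes_le_endRes_segment (ω : Sample d n) {l L : ℕ} (h : l + L ≤ n) :
    effRes ω.trace (ω.Phi l) (ω.Phi (l + L)) ≤ (ω.segment l L h).endRes := by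
  have h0 : shift (ω.pos l) l ((0 : Site d), 0) = ω.Phi l := by simp [shift, Phi]
  rw [← shift_Phi_segment ω h le_rfl, ← h0]
  exact (effRes_anti (map_trace_segment_le ω h) _ _).trans (effRes_map_le _ _ _ _)

lemma endRes_update_le (s : Fin n → Site d) (t : Fin (n + 1) → SpTree d) (j : Fin (n + 1))
    {a b : SpTree d} (hab : SpTree.Prunes a b) :
    endRes ((s, Function.update t j b) : Sample d n) ≤
      endRes ((s, Function.update t j a) : Sample d n) := by
  refine effRes_anti ?_ _ _
  rw [trace, trace]
  refine add_le_add le_rfl (Finset.sum_le_sum fun i _ => ?_)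
  by_cases hij : i = j
  · subst hij
    simp only [Function.update_self]
    exact hab.trace_le _ _
  · simp only [Function.update_of_ne hij]
    exact le_rfl

end Sample

end Trees

/-! ### Product measures and coordinatewise correlation -/

section Product

variable {α : Type*} [MeasurableSpace α] [Countable α] [MeasurableSingletonClass α]


lemma lintegral_pi_succ {N : ℕ} (μ : Fin (N + 1) → Measure α) [∀ i, SigmaFinite (μ i)]
    (F : (Fin (N + 1) → α) → ℝ≥0∞) :
    ∫⁻ t, F t ∂Measure.pi μ =
      ∫⁻ a, ∫⁻ t, F (Fin.cons a t) ∂(Measure.pi fun i : Fin N => μ i.succ) ∂(μ 0) := by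
  have h := (measurePreserving_piFinSuccAbove μ 0).symm
  rw [← h.lintegral_comp (Measurable.of_discrete (f := F)),
    lintegral_prod _ Measurable.of_discrete.aemeasurable]
  simp only [MeasurableEquiv.piFinSuccAbove_symm_apply, Fin.insertNthEquiv_zero,
    Fin.succAbove_zero]
  rfl

/-- If two classes of functions, one given by invariance under `e i` and one by monotonicity
under `r i`, are negatively correlated under `ρ i` for every coordinate `i`, up to replacing `ρ i`
by `σ i` for the second class, then this also holds for the product measures. -/
lemma lintegral_pi_mul_le {N : ℕ} (e r : Fin N → α → α → Prop) (ρ σ : Fin N → Measure α)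
    [∀ i, SigmaFinite (ρ i)] [∀ i, SigmaFinite (σ i)]
    (h : ∀ i, ∀ g f : α → ℝ≥0∞, (∀ a b, e i a b → g a = g b) → (∀ a b, r i a b → f b ≤ f a) →
      ∫⁻ a, g a * f a ∂(ρ i) ≤ (∫⁻ a, g a ∂(ρ i)) * ∫⁻ a, f a ∂(σ i))
    (g f : (Fin N → α) → ℝ≥0∞)
    (hg : ∀ i t a b, e i a b → g (Function.update t i a) = g (Function.update t i b))
    (hf : ∀ i t a b, r i a b → f (Function.update t i b) ≤ f (Function.update t i a)) :
    ∫⁻ t, g t * f t ∂Measure.pi ρ ≤ (∫⁻ t, g t ∂Measure.pi ρ) * ∫⁻ t, f t ∂Measure.pi σ := by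
  induction N with
  | zero =>
    rw [Measure.pi_of_empty, Measure.pi_of_empty]
    simp [lintegral_dirac]
  | succ N ih =>
    rw [lintegral_pi_succ, lintegral_pi_succ ρ, lintegral_pi_succ σ]
    -- With coordinate `0` frozen, the induction hypothesis decouples the others. The partial
    -- integrals inherit invariance and monotonicity in coordinate `0`, to which `h 0` then applies.
    calc _ ≤ ∫⁻ a, (∫⁻ t, g (Fin.cons a t) ∂(Measure.pi fun i : Fin N => ρ i.succ)) *
          (∫⁻ t, f (Fin.cons a t) ∂(Measure.pi fun i : Fin N => σ i.succ)) ∂(ρ 0) := by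
          refine lintegral_mono fun a => ?_
          refine ih (fun i => e i.succ) (fun i => r i.succ) (fun i => ρ i.succ)
            (fun i => σ i.succ) (fun i => h i.succ) (fun t => g (Fin.cons a t))
            (fun t => f (Fin.cons a t)) ?_ ?_
          · intro i t b c hbc
            simp only [Fin.cons_update]
            exact hg _ _ _ _ hbc
          · intro i t b c hbc
            simp only [Fin.cons_update]
            exact hf _ _ _ _ hbc
      _ ≤ _ := by
          refine h 0 _ _ ?_ ?_
          · intro a b hab
            refine lintegral_congr fun t => ?_
            have := hg 0 (Fin.cons a t) a b hab
            rwa [Fin.update_cons_zero, Fin.update_cons_zero] at this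
          · intro a b hab
            refine lintegral_mono fun t => ?_
            have := hf 0 (Fin.cons a t) a b hab
            rwa [Fin.update_cons_zero, Fin.update_cons_zero] at this

lemma measurePreserving_split {ι κ τ : Type*} [Fintype ι] [Fintype κ] [Fintype τ]
    {β : Type*} [MeasurableSpace β] (e : ι ⊕ κ ≃ τ) (μ : τ → Measure β) [∀ i, SigmaFinite (μ i)] :
    MeasurePreserving
      (fun t : τ → β => ((fun i => t (e (Sum.inl i)) : ι → β), (fun k => t (e (Sum.inr k)) : κ → β)))
      (Measure.pi μ)
      ((Measure.pi fun i => μ (e (Sum.inl i))).prod (Measure.pi fun k => μ (e (Sum.inr k)))) :=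
  (measurePreserving_sumPiEquivProdPi fun i => μ (e i)).comp
    (measurePreserving_piCongrLeft (α := fun _ => β) μ e).symm

lemma measurePreserving_comp_injective {ι τ : Type*} [Fintype ι] [Fintype τ]
    {β : Type*} [MeasurableSpace β] {φ : ι → τ} (hφ : φ.Injective) (μ : τ → Measure β)
    [∀ i, IsProbabilityMeasure (μ i)] :
    MeasurePreserving (fun (t : τ → β) i => t (φ i)) (Measure.pi μ)
      (Measure.pi fun i => μ (φ i)) := by
  classical
  let e := ((Equiv.ofInjective φ hφ).sumCongr (Equiv.refl _)).trans
    (Equiv.sumCompl fun x => x ∈ Set.range φ)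
  exact measurePreserving_fst.comp (measurePreserving_split e μ)

end Product

/-! ### Random walk bridges -/

section Walk

variable {d : ℕ}

lemma lintegral_toMeasure (P : PMF (Site d)) (f : Site d → ℝ≥0∞) :
    ∫⁻ z, f z ∂P.toMeasure = ∑' z, P z * f z := by
  rw [lintegral_countable']
  simp [PMF.toMeasure_apply_singleton, mul_comm]

lemma pi_sum_eq_nStep (P : PMF (Site d)) (n : ℕ) (x y : Site d) :
    Measure.pi (fun _ : Fin n => P.toMeasure) {s | x + ∑ r, s r = y} = nStep P n x y := by
  induction n generalizing x with
  | zero =>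
    rw [Measure.pi_of_empty]
    by_cases h : x = y <;> simp [nStep, h]
  | succ n ih =>
    rw [← lintegral_indicator_one (MeasurableSet.of_discrete), lintegral_pi_succ, nStep,
      ← (Equiv.addLeft x).tsum_eq, lintegral_toMeasure]
    refine tsum_congr fun z => ?_
    rw [Equiv.coe_addLeft, add_sub_cancel_left, ← ih, ← lintegral_indicator_one
      (MeasurableSet.of_discrete)]
    congr 1
    refine lintegral_congr fun t => ?_
    simp [Set.indicator, Fin.sum_univ_succ, add_assoc]

lemma pi_sum_eq_nStep' {κ : Type*} [Fintype κ] (P : PMF (Site d)) (x y : Site d) :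
    Measure.pi (fun _ : κ => P.toMeasure) {s | x + ∑ r, s r = y} =
      nStep P (Fintype.card κ) x y := by
  have h := measurePreserving_piCongrLeft (α := fun _ => Site d) (fun _ => P.toMeasure)
    (Fintype.equivFin κ).symm
  rw [← h.measure_preimage MeasurableSet.of_discrete.nullMeasurableSet, ← pi_sum_eq_nStep]
  congr 1
  ext s
  simp only [Set.mem_preimage, Set.mem_ofPred_eq]
  rw [← (Fintype.equivFin κ).symm.sum_comp]
  simp [MeasurableEquiv.coe_piCongrLeft, Equiv.piCongrLeft_apply_apply]

lemma nStep_ne_top (P : PMF (Site d)) (n : ℕ) (x y : Site d) : nStep P n x y ≠ ∞ := by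
  rw [← pi_sum_eq_nStep]
  exact measure_ne_top _ _

/-- Given the sum of all steps, a block of `L` steps is distributed like a random walk bridge. -/
lemma lintegral_block {n L : ℕ} (P : PMF (Site d)) (φ : Fin L → Fin n) (hφ : φ.Injective)
    (x : Site d) (f : (Fin L → Site d) → ℝ≥0∞) :
    ∫⁻ s in {s : Fin n → Site d | ∑ r, s r = x}, f (fun r => s (φ r))
        ∂(Measure.pi fun _ : Fin n => P.toMeasure) =
      ∑' y, nStep P (n - L) y x *
        ∫⁻ s in {s : Fin L → Site d | ∑ r, s r = y}, f s
          ∂(Measure.pi fun _ : Fin L => P.toMeasure) := by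
  classical
  let e := ((Equiv.ofInjective φ hφ).sumCongr (Equiv.refl _)).trans
    (Equiv.sumCompl fun x => x ∈ Set.range φ)
  have hcard : Fintype.card {x // ¬ x ∈ Set.range φ} = n - L := by
    rw [Fintype.card_subtype_compl, Fintype.card_fin]
    congr 1
    rw [← Fintype.card_congr (Equiv.ofInjective φ hφ), Fintype.card_fin]
  have h := measurePreserving_split e fun _ => P.toMeasure
  have h1 : ∀ s : Fin n → Site d, ∑ r, s r =
      ∑ i, s (e (Sum.inl i)) + ∑ k, s (e (Sum.inr k)) := fun s => by
    rw [← e.sum_comp, Fintype.sum_sum_type]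
  rw [← lintegral_indicator (MeasurableSet.of_discrete)]
  have h2 := h.lintegral_comp (f := fun p => f p.1 *
    Set.indicator {p : Site d × Site d | p.1 + p.2 = x} 1 (∑ i, p.1 i, ∑ k, p.2 k))
    Measurable.of_discrete
  calc _ = _ := by
        refine (lintegral_congr fun s => ?_).trans h2
        simp only [Set.indicator, Set.mem_ofPred_eq, h1]
        split_ifs <;> simp
        rfl
    -- The `n - L` steps outside the block are integrated out: they must lead from the sum of the
    -- block to `x`.
    _ = ∫⁻ s, f s * nStep P (n - L) (∑ i, s i) x ∂(Measure.pi fun _ : Fin L => P.toMeasure) := by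
        rw [lintegral_prod _ Measurable.of_discrete.aemeasurable]
        refine lintegral_congr fun s => ?_
        dsimp only
        rw [lintegral_const_mul _ Measurable.of_discrete, ← hcard, ← pi_sum_eq_nStep',
          ← lintegral_indicator_one (MeasurableSet.of_discrete)]
        rfl
    _ = ∫⁻ s, ∑' y, nStep P (n - L) y x * Set.indicator {s : Fin L → Site d | ∑ r, s r = y} f s
          ∂(Measure.pi fun _ : Fin L => P.toMeasure) := by
        refine lintegral_congr fun s => ?_
        rw [tsum_eq_single (∑ i, s i)]
        · simp [mul_comm]
        · intro y hy
          simp [Set.indicator, hy.symm]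
    _ = _ := by
        rw [lintegral_tsum fun _ => Measurable.of_discrete.aemeasurable]
        refine tsum_congr fun y => ?_
        rw [lintegral_const_mul _ Measurable.of_discrete,
          lintegral_indicator (MeasurableSet.of_discrete)]

end Walk

/-! ### Association inequalities -/

section Correlation

lemma mul_add_mul_le_of_antitone {x y u v : ℝ≥0∞} (hxy : x ≤ y) (huv : u ≤ v) :
    x * v + y * u ≤ x * u + y * v := by
  obtain ⟨D, rfl⟩ := exists_add_of_le hxy
  obtain ⟨E, rfl⟩ := exists_add_of_le huv
  ring_nf
  exact le_self_add

/-- Chebyshev's association inequality for a pair of weights with monotone likelihood ratio. -/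
lemma tsum_mul_tsum_le {X Y F : ℕ → ℝ≥0∞} (hXY : ∀ k l, k ≤ l → X k * Y l ≤ X l * Y k)
    (hF : Antitone F) :
    (∑' k, X k * F k) * (∑' l, Y l) ≤ (∑' k, Y k * F k) * (∑' l, X l) := by
  have prod_eq : ∀ A B : ℕ → ℝ≥0∞, (∑' k, A k) * (∑' l, B l) = ∑' k, ∑' l, A k * B l :=
    fun A B => by simp_rw [← ENNReal.tsum_mul_right, ← ENNReal.tsum_mul_left]
  have swap : ∀ A B : ℕ → ℝ≥0∞, (∑' k, A k) * (∑' l, B l) = ∑' k, ∑' l, A l * B k :=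
    fun A B => by rw [prod_eq, ENNReal.tsum_comm]
  -- Both sides are doubled and symmetrized in `(k, l)`, so that the inequality holds term by term.
  rw [← ENNReal.mul_le_mul_iff_right (a := 2) (by simp) (by simp), two_mul, two_mul]
  nth_rewrite 1 [prod_eq]
  nth_rewrite 1 [swap]
  nth_rewrite 1 [prod_eq]
  nth_rewrite 1 [swap]
  simp_rw [← ENNReal.tsum_add]
  refine ENNReal.tsum_le_tsum fun k => ENNReal.tsum_le_tsum fun l => ?_
  rcases le_total k l with h | h
  · have := mul_add_mul_le_of_antitone (hXY k l h) (hF h)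
    calc _ = X k * Y l * F k + X l * Y k * F l := by ring
      _ ≤ X k * Y l * F l + X l * Y k * F k := this
      _ = _ := by ring
  · have := mul_add_mul_le_of_antitone (hXY l k h) (hF h)
    calc _ = X l * Y k * F l + X k * Y l * F k := by ring
      _ ≤ X l * Y k * F k + X k * Y l * F l := this
      _ = _ := by ring

/-- On `T` the function `g` takes one value on `S` and one on `T \ S`. The mean of `f` over `T`
averages those over `S` and `T \ S`, so by `hf` the mean over `T \ S` is at most that over `S`. -/
lemma lintegral_cond_mul_le {α : Type*} [MeasurableSpace α] [DiscreteMeasurableSpace α]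
    (μ : Measure α) {S T : Set α} (hST : S ⊆ T) (hS : μ S ≠ 0) (hT : μ T ≠ ∞)
    {f : α → ℝ≥0∞} (hf : (∫⁻ a in T, f a ∂μ) * μ S ≤ (∫⁻ a in S, f a ∂μ) * μ T)
    {g : α → ℝ≥0∞} (hg : ∀ a b, (a ∈ S ↔ b ∈ S) → g a = g b) :
    ∫⁻ a, g a * f a ∂(cond μ T) ≤ (∫⁻ a, g a ∂(cond μ T)) * ∫⁻ a, f a ∂(cond μ S) := by
  classical
  obtain ⟨c₁, c₂, hc₁, hc₂⟩ : ∃ c₁ c₂, (∀ a ∈ S, g a = c₁) ∧ ∀ a ∈ T \ S, g a = c₂ := by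
    obtain ⟨s, hs⟩ := nonempty_of_measure_ne_zero hS
    by_cases h : ∃ t, t ∉ S
    · obtain ⟨t, ht⟩ := h
      exact ⟨g s, g t, fun a ha => hg _ _ (by tauto), fun a ha => hg _ _ (by have := ha.2; tauto)⟩
    · exact ⟨g s, 0, fun a ha => hg _ _ (by tauto), fun a ha => absurd ⟨a, ha.2⟩ h⟩
  have split : ∀ F : α → ℝ≥0∞,
      ∫⁻ a in T, F a ∂μ = ∫⁻ a in S, F a ∂μ + ∫⁻ a in T \ S, F a ∂μ := fun F => by
    rw [← lintegral_union MeasurableSet.of_discrete Set.disjoint_sdiff_right,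
      Set.union_sdiff_cancel hST]
  have on_S : ∀ F : α → ℝ≥0∞, ∫⁻ a in S, g a * F a ∂μ = c₁ * ∫⁻ a in S, F a ∂μ := fun F => by
    rw [← lintegral_const_mul _ Measurable.of_discrete]
    exact setLIntegral_congr_fun MeasurableSet.of_discrete fun a ha => by rw [hc₁ a ha]
  have off_S : ∀ F : α → ℝ≥0∞, ∫⁻ a in T \ S, g a * F a ∂μ = c₂ * ∫⁻ a in T \ S, F a ∂μ :=
    fun F => by
      rw [← lintegral_const_mul _ Measurable.of_discrete]
      exact setLIntegral_congr_fun MeasurableSet.of_discrete fun a ha => by rw [hc₂ a ha]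
  have hSt : μ S ≠ ∞ := ne_top_of_le_ne_top hT (measure_mono hST)
  have hμ : μ T = μ S + μ (T \ S) := by
    rw [← measure_union Set.disjoint_sdiff_right MeasurableSet.of_discrete,
      Set.union_sdiff_cancel hST]
  have key : ∫⁻ a in T \ S, f a ∂μ ≤ μ (T \ S) * ((μ S)⁻¹ * ∫⁻ a in S, f a ∂μ) := by
    set A := ∫⁻ a in S, f a ∂μ
    set B := ∫⁻ a in T \ S, f a ∂μ with hB
    by_cases hv : μ (T \ S) = 0
    · rw [hB, setLIntegral_measure_zero _ _ hv]
      exact bot_le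
    by_cases hA : A = ∞
    · rw [hA, ENNReal.mul_top (ENNReal.inv_ne_zero.2 hSt), ENNReal.mul_top hv]
      exact le_top
    rw [split, hμ, add_mul, mul_add] at hf
    have h1 := (ENNReal.add_le_add_iff_left (ENNReal.mul_ne_top hA hSt)).1 hf
    calc B = B * μ S * (μ S)⁻¹ := by rw [mul_assoc, ENNReal.mul_inv_cancel hS hSt, mul_one]
      _ ≤ A * μ (T \ S) * (μ S)⁻¹ := by gcongr
      _ = _ := by ring
  have h1 : ∫⁻ a in T, g a ∂μ = c₁ * μ S + c₂ * μ (T \ S) := by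
    have h2 := on_S 1
    have h3 := off_S 1
    simp only [Pi.one_apply, mul_one, setLIntegral_one] at h2 h3
    rw [split, h2, h3]
  rw [ProbabilityTheory.cond, ProbabilityTheory.cond, lintegral_smul_measure,
    lintegral_smul_measure, lintegral_smul_measure, split, on_S, off_S, h1]
  simp only [smul_eq_mul]
  rw [mul_assoc]
  gcongr
  rw [add_mul]
  refine add_le_add ?_ ?_
  · rw [mul_assoc, ← mul_assoc (μ S), ENNReal.mul_inv_cancel hS hSt, one_mul]
  · rw [mul_assoc]
    gcongr

end Correlation

/-! ### Critical trees conditioned on their height -/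

section Law

variable {d : ℕ}

/-- The weight of a tree when the root has offspring weights `a`, and the later vertices have
offspring law `p`. -/
noncomputable def rootedWeight (a : ℕ → ℝ≥0∞) (p : PMF ℕ) (P : PMF (Site d)) :
    SpTree d → ℝ≥0∞
  | SpTree.node k step child => a k * ∏ i, (P (step i) * (child i).weight p P)

/-- The corresponding measure on finite trees. -/
noncomputable def rootedLaw (a : ℕ → ℝ≥0∞) (p : PMF ℕ) (P : PMF (Site d)) :
    Measure (SpTree d) :=
  Measure.count.withDensity (rootedWeight a p P)

lemma treeLaw_eq_rootedLaw (p : PMF ℕ) (P : PMF (Site d)) :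
    treeLaw p P = rootedLaw (fun k => ((k + 1 : ℕ) : ℝ≥0∞) * p (k + 1)) p P := by
  unfold treeLaw rootedLaw
  congr 1

lemma rootedWeight_self (p : PMF ℕ) (P : PMF (Site d)) (t : SpTree d) :
    rootedWeight p p P t = t.weight p P := by
  cases t
  rfl

lemma rootedLaw_singleton (a : ℕ → ℝ≥0∞) (p : PMF ℕ) (P : PMF (Site d)) (t : SpTree d) :
    rootedLaw a p P {t} = rootedWeight a p P t := by
  rw [rootedLaw, withDensity_apply _ MeasurableSet.of_discrete, lintegral_singleton]
  simp

/-- The trees of height less than `h`. -/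
def lowTrees (d h : ℕ) : Set (SpTree d) := {t | t.height < h}

lemma lowTrees_mono {h H : ℕ} (hH : h ≤ H) : lowTrees d h ⊆ lowTrees d H :=
  fun _ ht => lt_of_lt_of_le ht hH

lemma restrict_singleton' {α : Type*} [MeasurableSpace α] [MeasurableSingletonClass α]
    (μ : Measure α) (S : Set α) (t : α) :
    μ.restrict S {t} = S.indicator (fun t => μ {t}) t := by
  rw [Measure.restrict_apply (MeasurableSet.singleton t)]
  by_cases h : t ∈ S <;> simp [h]

/-- The decomposition of a tree at the root. -/
lemma lintegral_rootedLaw (a : ℕ → ℝ≥0∞) (p : PMF ℕ) (P : PMF (Site d)) (h : ℕ)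
    [IsFiniteMeasure ((rootedLaw p p P).restrict (lowTrees d h))] (f : SpTree d → ℝ≥0∞) :
    ∫⁻ t in lowTrees d (h + 1), f t ∂(rootedLaw a p P) =
      ∑' k, a k * ∫⁻ s, ∫⁻ c, f (SpTree.node k s c)
        ∂(Measure.pi fun _ : Fin k => (rootedLaw p p P).restrict (lowTrees d h))
        ∂(Measure.pi fun _ : Fin k => P.toMeasure) := by
  classical
  rw [lintegral_countable', ← (SpTree.equivSigma d).symm.tsum_eq, ENNReal.tsum_sigma']
  refine tsum_congr fun k => ?_
  rw [lintegral_countable', ENNReal.tsum_prod', ← ENNReal.tsum_mul_left]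
  refine tsum_congr fun s => ?_
  rw [lintegral_countable', ← ENNReal.tsum_mul_right, ← ENNReal.tsum_mul_left]
  refine tsum_congr fun c => ?_
  simp only [Measure.pi_singleton, restrict_singleton', rootedLaw_singleton,
    PMF.toMeasure_apply_singleton _ _ (MeasurableSet.singleton _)]
  change f (SpTree.node k s c) * (lowTrees d (h + 1)).indicator _ (SpTree.node k s c) = _
  by_cases hc : SpTree.node k s c ∈ lowTrees d (h + 1)
  · have hc' : ∀ i, c i ∈ lowTrees d h := SpTree.height_node_lt.1 hc
    simp only [Set.indicator_of_mem hc, Set.indicator_of_mem (hc' _), rootedWeight_self]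
    rw [rootedWeight, Finset.prod_mul_distrib]
    ring
  · have : ∃ i, c i ∉ lowTrees d h := by
      by_contra! hcon
      exact hc (SpTree.height_node_lt.2 hcon)
    obtain ⟨i, hi⟩ := this
    rw [Set.indicator_of_notMem hc, Finset.prod_eq_zero (Finset.mem_univ i)
      (Set.indicator_of_notMem hi _)]
    simp

/-- The masses are iterates of the generating function of `p`. The induction also supplies the
finiteness that the decomposition at the root requires. -/
lemma rootedLaw_lowTrees_le (p : PMF ℕ) (P : PMF (Site d)) (h : ℕ) :
    rootedLaw p p P (lowTrees d h) ≤ 1 := by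
  induction h with
  | zero => simp [lowTrees]
  | succ h ih =>
    have : IsFiniteMeasure ((rootedLaw p p P).restrict (lowTrees d h)) :=
      ⟨by rw [Measure.restrict_apply_univ]; exact ih.trans_lt ENNReal.one_lt_top⟩
    have h1 := lintegral_rootedLaw p p P h 1
    simp only [Pi.one_apply, lintegral_const, Measure.restrict_apply_univ, Measure.pi_univ,
      measure_univ, Finset.prod_const, mul_one, one_mul] at h1
    rw [h1, ← p.tsum_coe]
    refine ENNReal.tsum_le_tsum fun k => ?_
    exact mul_le_of_le_one_right' (pow_le_one' ih _)

instance (p : PMF ℕ) (P : PMF (Site d)) (h : ℕ) :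
    IsFiniteMeasure ((rootedLaw p p P).restrict (lowTrees d h)) :=
  ⟨by
    rw [Measure.restrict_apply_univ]
    exact (rootedLaw_lowTrees_le p P h).trans_lt ENNReal.one_lt_top⟩

lemma rootedLaw_lowTrees_ne_zero {p : PMF ℕ} (hp : p 0 ≠ 0) (P : PMF (Site d)) {h : ℕ}
    (hh : h ≠ 0) : rootedLaw p p P (lowTrees d h) ≠ 0 := by
  have hmem : SpTree.node 0 Fin.elim0 Fin.elim0 ∈ lowTrees d h := by
    simp [lowTrees, SpTree.height, Nat.pos_of_ne_zero hh]
  refine ne_of_gt (lt_of_lt_of_le ?_ (measure_mono (Set.singleton_subset_iff.2 hmem)))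
  rw [rootedLaw_singleton]
  simp [rootedWeight, pos_iff_ne_zero, hp]

/-- The witness is a root with `k` leaves. The bound `2 ≤ h` leaves room for it, since `a 0` may
vanish: for the law `p̃` it is `p 1`. -/
lemma rootedLaw_lowTrees_ne_zero' {a : ℕ → ℝ≥0∞} {p : PMF ℕ} (hp : p 0 ≠ 0) {k : ℕ} (hk : a k ≠ 0)
    (P : PMF (Site d)) {h : ℕ} (hh : 2 ≤ h) : rootedLaw a p P (lowTrees d h) ≠ 0 := by
  obtain ⟨z, hz⟩ := P.support_nonempty
  let t : SpTree d :=
    SpTree.node k (fun _ => z) fun _ => SpTree.node 0 Fin.elim0 Fin.elim0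
  have hmem : t ∈ lowTrees d h := by
    refine lowTrees_mono hh ?_
    refine SpTree.height_node_lt.2 fun i => ?_
    simp [SpTree.height]
  refine ne_of_gt (lt_of_lt_of_le ?_ (measure_mono (Set.singleton_subset_iff.2 hmem)))
  rw [rootedLaw_singleton, pos_iff_ne_zero]
  have hz' : P z ≠ 0 := (P.mem_support_iff z).1 hz
  simp [rootedWeight, t, SpTree.weight, hk, hp, hz']

lemma pi_const_smul {α : Type*} [MeasurableSpace α] (μ : Measure α) [IsFiniteMeasure μ]
    {c : ℝ≥0∞} (hc : c ≠ ∞) (k : ℕ) :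
    (Measure.pi fun _ : Fin k => c • μ) = c ^ k • Measure.pi fun _ : Fin k => μ := by
  have : IsFiniteMeasure (c • μ) := μ.smul_finite hc
  refine Measure.pi_eq fun s _ => ?_
  simp [Measure.smul_apply, Measure.pi_pi, Finset.prod_mul_distrib]

/-- The law of a critical tree with displacements, conditioned on height less than `h`. -/
noncomputable def lowLaw (p : PMF ℕ) (P : PMF (Site d)) (h : ℕ) : Measure (SpTree d) :=
  cond (rootedLaw p p P) (lowTrees d h)

instance (p : PMF ℕ) (P : PMF (Site d)) (h : ℕ) : IsFiniteMeasure (lowLaw p P h) := by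
  unfold lowLaw; infer_instance

lemma isProbabilityMeasure_lowLaw {p : PMF ℕ} (hp : p 0 ≠ 0) (P : PMF (Site d)) {h : ℕ}
    (hh : h ≠ 0) : IsProbabilityMeasure (lowLaw p P h) :=
  cond_isProbabilityMeasure_of_finite (rootedLaw_lowTrees_ne_zero hp P hh)
    (ne_top_of_le_ne_top ENNReal.one_ne_top (rootedLaw_lowTrees_le p P h))

/-- The expectation of a function of a tree with `k` children at the root and
conditioned subtrees. -/
noncomputable def childMean (p : PMF ℕ) (P : PMF (Site d)) (h : ℕ) (f : SpTree d → ℝ≥0∞)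
    (k : ℕ) : ℝ≥0∞ :=
  ∫⁻ s, ∫⁻ c, f (SpTree.node k s c) ∂(Measure.pi fun _ : Fin k => lowLaw p P h)
    ∂(Measure.pi fun _ : Fin k => P.toMeasure)

lemma lintegral_rootedLaw_childMean (a : ℕ → ℝ≥0∞) {p : PMF ℕ} (hp : p 0 ≠ 0) (P : PMF (Site d))
    {h : ℕ} (hh : h ≠ 0) (f : SpTree d → ℝ≥0∞) :
    ∫⁻ t in lowTrees d (h + 1), f t ∂(rootedLaw a p P) =
      ∑' k, a k * rootedLaw p p P (lowTrees d h) ^ k * childMean p P h f k := by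
  have hq := rootedLaw_lowTrees_ne_zero hp P hh
  have hq' := ne_top_of_le_ne_top ENNReal.one_ne_top (rootedLaw_lowTrees_le p P h)
  have h1 : (rootedLaw p p P).restrict (lowTrees d h) =
      rootedLaw p p P (lowTrees d h) • lowLaw p P h := by
    rw [lowLaw, ProbabilityTheory.cond, smul_smul, ENNReal.mul_inv_cancel hq hq', one_smul]
  rw [lintegral_rootedLaw]
  refine tsum_congr fun k => ?_
  rw [h1, pi_const_smul _ hq', mul_assoc, childMean]
  simp only [lintegral_smul_measure, smul_eq_mul]
  rw [lintegral_const_mul _ Measurable.of_discrete]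

lemma rootedLaw_lowTrees_succ (a : ℕ → ℝ≥0∞) {p : PMF ℕ} (hp : p 0 ≠ 0) (P : PMF (Site d))
    {h : ℕ} (hh : h ≠ 0) :
    rootedLaw a p P (lowTrees d (h + 1)) =
      ∑' k, a k * rootedLaw p p P (lowTrees d h) ^ k := by
  have := isProbabilityMeasure_lowLaw hp P hh
  have h1 := lintegral_rootedLaw_childMean a hp P hh 1
  simpa [childMean] using h1

/-- Coupling: the first `k` of `l` independent children are `k` independent children, and dropping
the others is a pruning. -/
lemma childMean_antitone {p : PMF ℕ} (hp : p 0 ≠ 0) (P : PMF (Site d)) {h : ℕ} (hh : h ≠ 0)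
    {f : SpTree d → ℝ≥0∞} (hf : ∀ t t', SpTree.Prunes t t' → f t' ≤ f t) :
    Antitone (childMean p P h f) := by
  intro k l hkl
  have := isProbabilityMeasure_lowLaw hp P hh
  have h1 := measurePreserving_comp_injective (Fin.castLE_injective hkl)
    fun _ : Fin l => lowLaw p P h
  have h2 := measurePreserving_comp_injective (Fin.castLE_injective hkl)
    fun _ : Fin l => P.toMeasure
  unfold childMean
  rw [← h2.lintegral_comp Measurable.of_discrete]
  refine lintegral_mono fun s => ?_
  rw [← h1.lintegral_comp Measurable.of_discrete]
  refine lintegral_mono fun c => hf _ _ ?_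
  exact SpTree.Prunes.node hkl _ _ _ _ (fun _ => rfl) fun _ => SpTree.Prunes.refl _

lemma childMean_le {p : PMF ℕ} (hp : p 0 ≠ 0) (P : PMF (Site d)) {h H : ℕ} (hh : h ≠ 0)
    (hH : H ≠ 0)
    (ih : ∀ f : SpTree d → ℝ≥0∞, (∀ t t', SpTree.Prunes t t' → f t' ≤ f t) →
      ∫⁻ t, f t ∂(lowLaw p P H) ≤ ∫⁻ t, f t ∂(lowLaw p P h))
    {f : SpTree d → ℝ≥0∞} (hf : ∀ t t', SpTree.Prunes t t' → f t' ≤ f t) (k : ℕ) :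
    childMean p P H f k ≤ childMean p P h f k := by
  have := isProbabilityMeasure_lowLaw hp P hh
  have := isProbabilityMeasure_lowLaw hp P hH
  refine lintegral_mono fun s => ?_
  have := lintegral_pi_mul_le (fun _ : Fin k => fun _ _ => True) (fun _ => SpTree.Prunes)
    (fun _ => lowLaw p P H) (fun _ => lowLaw p P h) ?_ 1 (fun c => f (SpTree.node k s c)) ?_ ?_
  · simpa using this
  · intro _ g f' hg hf'
    obtain ⟨c, rfl⟩ : ∃ c, g = fun _ => c :=
      ⟨g (Classical.arbitrary _), funext fun _ => hg _ _ trivial⟩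
    rw [lintegral_const_mul _ Measurable.of_discrete, lintegral_const, measure_univ, mul_one]
    exact mul_le_mul' le_rfl (ih _ hf')
  · intros; rfl
  · intro i c a b hab
    refine hf _ _ (SpTree.Prunes.node le_rfl _ _ _ _ (fun _ => rfl) fun j => ?_)
    by_cases hij : j = i
    · subst hij
      simpa using hab
    · simpa [Function.update_of_ne hij] using SpTree.Prunes.refl _

/-- Conditioning a tree to be lower makes it stochastically smaller. -/
lemma lintegral_lowTrees_mul_le {p : PMF ℕ} (hp : p 0 ≠ 0) (P : PMF (Site d)) {h H : ℕ}
    (hH : h ≤ H) (a : ℕ → ℝ≥0∞)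
    {f : SpTree d → ℝ≥0∞} (hf : ∀ t t', SpTree.Prunes t t' → f t' ≤ f t) :
    (∫⁻ t in lowTrees d H, f t ∂(rootedLaw a p P)) * rootedLaw a p P (lowTrees d h) ≤
      (∫⁻ t in lowTrees d h, f t ∂(rootedLaw a p P)) * rootedLaw a p P (lowTrees d H) := by
  induction h generalizing H a f with
  | zero => simp [lowTrees]
  | succ h ih =>
    obtain ⟨H, rfl⟩ : ∃ H', H = H' + 1 := ⟨H - 1, by omega⟩
    -- Height below `1` forces a leaf, which is a pruning of every tree and so maximizes `f`. This
    -- case is separate because subtrees of height below `0` do not exist and cannot be conditioned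
    -- on.
    rcases Nat.eq_zero_or_pos h with rfl | hpos
    · let leaf : SpTree d := SpTree.node 0 Fin.elim0 Fin.elim0
      have h1 : ∫⁻ t in lowTrees d (H + 1), f t ∂(rootedLaw a p P) ≤
          f leaf * rootedLaw a p P (lowTrees d (H + 1)) := by
        rw [← setLIntegral_const]
        exact lintegral_mono fun t => hf _ _ (SpTree.Prunes.leaf _ _ _)
      have h2 : f leaf * rootedLaw a p P (lowTrees d (0 + 1)) ≤
          ∫⁻ t in lowTrees d (0 + 1), f t ∂(rootedLaw a p P) := by
        rw [← setLIntegral_const]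
        refine setLIntegral_mono' MeasurableSet.of_discrete fun t ht => hf _ _ ?_
        obtain ⟨k, s, c⟩ := t
        rcases k with - | k
        · exact SpTree.Prunes.leaf _ _ _
        · exact absurd (SpTree.height_node_lt.1 ht 0) (by simp)
      calc _ ≤ f leaf * rootedLaw a p P (lowTrees d (H + 1)) *
            rootedLaw a p P (lowTrees d (0 + 1)) := by gcongr
        _ = f leaf * rootedLaw a p P (lowTrees d (0 + 1)) *
            rootedLaw a p P (lowTrees d (H + 1)) := by ring
        _ ≤ _ := by gcongr
    have hh : h ≠ 0 := hpos.ne'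
    have hH' : H ≠ 0 := by omega
    -- The induction hypothesis with root weights `p`, the law of the subtrees.
    have ih' : ∀ f : SpTree d → ℝ≥0∞, (∀ t t', SpTree.Prunes t t' → f t' ≤ f t) →
        ∫⁻ t, f t ∂(lowLaw p P H) ≤ ∫⁻ t, f t ∂(lowLaw p P h) := by
      intro f hf
      have h1 := ih (show h ≤ H by omega) p hf
      have hq := rootedLaw_lowTrees_ne_zero hp P hh
      have hq' := ne_top_of_le_ne_top ENNReal.one_ne_top (rootedLaw_lowTrees_le p P h)
      have hQ := rootedLaw_lowTrees_ne_zero hp P hH'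
      have hQ' := ne_top_of_le_ne_top ENNReal.one_ne_top (rootedLaw_lowTrees_le p P H)
      unfold lowLaw ProbabilityTheory.cond
      rw [lintegral_smul_measure, lintegral_smul_measure, smul_eq_mul, smul_eq_mul,
        mul_comm, ← div_eq_mul_inv, ENNReal.div_le_iff hQ hQ', mul_assoc, mul_comm,
        ← div_eq_mul_inv, ENNReal.le_div_iff_mul_le (Or.inl hq) (Or.inl hq')]
      exact h1
    rw [lintegral_rootedLaw_childMean a hp P hh, lintegral_rootedLaw_childMean a hp P hH',
      rootedLaw_lowTrees_succ a hp P hh, rootedLaw_lowTrees_succ a hp P hH']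
    set q := rootedLaw p p P (lowTrees d h)
    set Q := rootedLaw p p P (lowTrees d H)
    have hqQ : q ≤ Q := measure_mono (lowTrees_mono (by omega))
    -- First the subtrees are lowered for a fixed number of children, then that number is compared:
    -- the likelihood ratio `(Q / q) ^ k` increases in `k`.
    calc _ ≤ (∑' k, a k * Q ^ k * childMean p P h f k) * ∑' k, a k * q ^ k := by
          gcongr with k
          exact childMean_le hp P hh hH' ih' hf k
      _ ≤ _ := by
          refine tsum_mul_tsum_le (fun k l hkl => ?_) (childMean_antitone hp P hh hf)
          obtain ⟨m, rfl⟩ := Nat.exists_eq_add_of_le hkl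
          calc a k * Q ^ k * (a (k + m) * q ^ (k + m)) =
                a k * a (k + m) * Q ^ k * q ^ k * q ^ m := by ring
            _ ≤ a k * a (k + m) * Q ^ k * q ^ k * Q ^ m := by gcongr
            _ = _ := by ring

end Law

/-- If `p 0 = 0`, mean one concentrates `p` at `1`, against positive variance. -/
lemma ProgenyAssumptions.zero_ne_zero {p : PMF ℕ} (hp : ProgenyAssumptions p) : p 0 ≠ 0 := by
  intro h0
  have h1 : ∑' k : ℕ, (k : ℝ≥0∞) * p k = ∑' k, ((k - 1 : ℕ) : ℝ≥0∞) * p k + ∑' k, p k := by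
    rw [← ENNReal.tsum_add]
    refine tsum_congr fun k => ?_
    rcases k with - | k
    · simp [h0]
    · push_cast [Nat.add_sub_cancel]
      ring
  rw [hp.mean_one, p.tsum_coe] at h1
  have h2 : ∑' k, ((k - 1 : ℕ) : ℝ≥0∞) * p k = 0 :=
    (ENNReal.add_right_inj ENNReal.one_ne_top).1 (by rw [add_zero, add_comm, ← h1])
  refine hp.variance_pos.ne' (ENNReal.tsum_eq_zero.2 fun k => ?_)
  have h3 := ENNReal.tsum_eq_zero.1 h2 k
  rw [Nat.cast_mul, mul_assoc, h3, mul_zero]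

lemma ProgenyAssumptions.exists_succ_ne_zero {p : PMF ℕ} (hp : ProgenyAssumptions p) :
    ∃ k : ℕ, ((k + 1 : ℕ) : ℝ≥0∞) * p (k + 1) ≠ 0 := by
  by_contra! h
  have : ∑' k : ℕ, (k : ℝ≥0∞) * p k = 0 := ENNReal.tsum_eq_zero.2 fun k => by
    rcases k with - | k
    · simp
    · exact h k
  simp [hp.mean_one] at this

/-! ### The failure event and the resistance of one block -/

section Conditioned

variable {d : ℕ} (p : PMF ℕ) (P : PMF (Site d))

/-- The law of the tree attached at `V_j` in `𝒯_{n,m}`. -/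
noncomputable def branchLaw (m j : ℕ) : Measure (SpTree d) :=
  cond (treeLaw p P) {t : SpTree d | j + t.height < m}

instance (m j : ℕ) : IsFiniteMeasure (branchLaw p P m j) := by
  unfold branchLaw; infer_instance

variable {p P}

lemma setOf_add_height_lt (m j : ℕ) :
    {t : SpTree d | j + t.height < m} = lowTrees d (m - j) := by
  ext t
  simp only [lowTrees, Set.mem_ofPred_eq]
  omega

lemma branchLaw_add (m l j : ℕ) : branchLaw p P m (l + j) = branchLaw p P (m - l) j := by
  unfold branchLaw
  rw [setOf_add_height_lt, setOf_add_height_lt, Nat.sub_sub]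

/-- Conditioning on a set of infinite mass gives the zero measure. This provides finiteness of
`treeLaw` on the conditioning set. -/
lemma cond_ne_top {α : Type*} [MeasurableSpace α] {μ : Measure α} {s : Set α}
    (h : IsProbabilityMeasure (cond μ s)) : μ s ≠ ∞ := by
  intro h1
  have h2 : cond μ s Set.univ = 1 := measure_univ
  simp [ProbabilityTheory.cond, h1] at h2

lemma branchLaw_prob (hp : ProgenyAssumptions p) {m m' j : ℕ}
    (hm : IsProbabilityMeasure (branchLaw p P m j)) (hj : j + 2 ≤ m') (hm' : m' ≤ m) :
    IsProbabilityMeasure (branchLaw p P m' j) := by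
  obtain ⟨k, hk⟩ := hp.exists_succ_ne_zero
  have h1 := cond_ne_top hm
  unfold branchLaw
  refine cond_isProbabilityMeasure_of_finite ?_
    (ne_top_of_le_ne_top h1 (measure_mono fun t ht => lt_of_lt_of_le ht hm'))
  rw [setOf_add_height_lt, treeLaw_eq_rootedLaw]
  exact rootedLaw_lowTrees_ne_zero' (a := fun k => ((k + 1 : ℕ) : ℝ≥0∞) * p (k + 1))
    hp.zero_ne_zero hk P (by omega)

/-- Under the law of a branch, functions of the event of being low and functions that decrease with
the tree are negatively correlated, up to conditioning the tree to be low for the latter. -/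
lemma branchLaw_mul_le (hp : ProgenyAssumptions p) {m m' j : ℕ}
    (hm : IsProbabilityMeasure (branchLaw p P m j)) (hj : j + 2 ≤ m') (hm' : m' ≤ m)
    {g f : SpTree d → ℝ≥0∞}
    (hg : ∀ a b : SpTree d, (m' ≤ j + a.height ↔ m' ≤ j + b.height) → g a = g b)
    (hf : ∀ a b, SpTree.Prunes a b → f b ≤ f a) :
    ∫⁻ t, g t * f t ∂(branchLaw p P m j) ≤
      (∫⁻ t, g t ∂(branchLaw p P m j)) * ∫⁻ t, f t ∂(branchLaw p P m' j) := by
  obtain ⟨k, hk⟩ := hp.exists_succ_ne_zero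
  have h1 := cond_ne_top hm
  unfold branchLaw
  simp only [setOf_add_height_lt, treeLaw_eq_rootedLaw] at h1 ⊢
  refine lintegral_cond_mul_le _ (lowTrees_mono (by omega)) ?_ h1
    (lintegral_lowTrees_mul_le hp.zero_ne_zero P (by omega) _ hf) ?_
  · exact rootedLaw_lowTrees_ne_zero' (a := fun k => ((k + 1 : ℕ) : ℝ≥0∞) * p (k + 1))
      hp.zero_ne_zero hk P (by omega)
  · intro a b hab
    refine hg a b ?_
    simp only [lowTrees, Set.mem_ofPred_eq] at hab
    omega

lemma law_eq (n m : ℕ) :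
    law p P n m = (Measure.pi fun _ : Fin n => P.toMeasure).prod
      (Measure.pi fun j : Fin (n + 1) => branchLaw p P m j) := rfl

lemma endpoint_eq (n : ℕ) (x : Site d) :
    endpoint n x = {s : Fin n → Site d | ∑ r, s r = x} ×ˢ Set.univ := by
  ext ω
  simp [endpoint, Sample.Phi, Sample.pos]

/-- Only an inequality, since the law vanishes when some tree is conditioned on a null event. -/
lemma law_endpoint_le (n m : ℕ) (x : Site d) : law p P n m (endpoint n x) ≤ nStep P n 0 x := by
  rw [law_eq, endpoint_eq, Measure.prod_prod, ← pi_sum_eq_nStep]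
  simp only [zero_add]
  refine mul_le_of_le_one_right' ?_
  rw [Measure.pi_univ]
  refine Finset.prod_le_one' fun j _ => ?_
  unfold branchLaw
  exact prob_le_one

lemma lintegral_endpoint_le (n m : ℕ) (hm : 2 * n ≤ m) (x : Site d) :
    ∫⁻ s in {s : Fin n → Site d | ∑ r, s r = x},
        ∫⁻ t, Sample.endRes ((s, t) : Sample d n)
          ∂(Measure.pi fun j : Fin (n + 1) => branchLaw p P m j)
        ∂(Measure.pi fun _ : Fin n => P.toMeasure) ≤
      nStep P n 0 x * gamma p P n x := by
  have h1 : ∫⁻ ω in endpoint n x, ω.endRes ∂(law p P n m) ≤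
      law p P n m (endpoint n x) * gamma p P n x := by
    have htop : law p P n m (endpoint n x) ≠ ∞ :=
      ne_top_of_le_ne_top (nStep_ne_top P n 0 x) (law_endpoint_le n m x)
    by_cases h0 : law p P n m (endpoint n x) = 0
    · rw [setLIntegral_measure_zero _ _ h0]
      exact bot_le
    have h2 : ∫⁻ ω, ω.endRes ∂(cond (law p P n m) (endpoint n x)) ≤ gamma p P n x :=
      le_iSup₂ (f := fun m (_ : 2 * n ≤ m) =>
        ∫⁻ ω, Sample.endRes ω ∂(cond (law p P n m) (endpoint n x))) m hm
    rw [ProbabilityTheory.cond, lintegral_smul_measure, smul_eq_mul, mul_comm,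
      ← div_eq_mul_inv, ENNReal.div_le_iff h0 htop] at h2
    rwa [mul_comm]
  rw [law_eq, endpoint_eq, ← Measure.prod_restrict, Measure.restrict_univ,
    lintegral_prod _ Measurable.of_discrete.aemeasurable, ← endpoint_eq, ← law_eq] at h1
  exact h1.trans (mul_le_mul' (law_endpoint_le n m x) le_rfl)

lemma condOne_congr {n : ℕ} {ω ω' : Sample d n} {L i : ℕ}
    (h : ∀ ℓ : Fin (n + 1), i * L ≤ (ℓ : ℕ) → (ℓ : ℕ) < (i + 1) * L →
      (ω.Reaches ℓ ((i + 2) * L) ↔ ω'.Reaches ℓ ((i + 2) * L))) :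
    ω.CondOne L i ↔ ω'.CondOne L i := by
  have h1 : ∀ ℓ, ω.LongBranch L i ℓ ↔ ω'.LongBranch L i ℓ := by
    intro ℓ
    unfold Sample.LongBranch
    constructor
    · rintro ⟨a, b, c⟩
      exact ⟨a, b, (h ℓ a b).1 c⟩
    · rintro ⟨a, b, c⟩
      exact ⟨a, b, (h ℓ a b).2 c⟩
  unfold Sample.CondOne
  simp only [h1]

lemma not_condOne_one {n : ℕ} (ω : Sample d n) (i : ℕ) : ¬ ω.CondOne 1 i := by
  rintro ⟨ℓ, ⟨h1, h2, -⟩, -, h3, -⟩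
  have h4 : (ℓ : ℕ) = i := by omega
  rw [h4] at h3
  norm_num at h3

/-- The event that the first condition of tree-goodness fails, in terms of the attached trees. -/
def failTrees (d n L i : ℕ) : Set (Fin (n + 1) → SpTree d) :=
  {t | ¬ Sample.CondOne ((0, t) : Sample d n) L i}

lemma failOne_inter_endpoint (n L i : ℕ) (x : Site d) :
    failOne d n L i ∩ endpoint n x =
      {s : Fin n → Site d | ∑ r, s r = x} ×ˢ failTrees d n L i := by
  rw [endpoint_eq]
  ext ω
  simp only [Set.mem_inter_iff, Set.mem_prod, Set.mem_univ, and_true]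
  exact and_comm

lemma indicator_failTrees_update {n L i : ℕ} {ℓ : Fin (n + 1)} (t : Fin (n + 1) → SpTree d)
    {a b : SpTree d}
    (h : i * L ≤ (ℓ : ℕ) → (ℓ : ℕ) < (i + 1) * L →
      ((i + 2) * L ≤ (ℓ : ℕ) + a.height ↔ (i + 2) * L ≤ (ℓ : ℕ) + b.height)) :
    (failTrees d n L i).indicator (1 : (Fin (n + 1) → SpTree d) → ℝ≥0∞) (Function.update t ℓ a) =
      (failTrees d n L i).indicator 1 (Function.update t ℓ b) := by
  classical
  have h1 : Function.update t ℓ a ∈ failTrees d n L i ↔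
      Function.update t ℓ b ∈ failTrees d n L i := by
    refine not_congr (condOne_congr fun ℓ' h1 h2 => ?_)
    unfold Sample.Reaches
    by_cases hℓ : ℓ' = ℓ
    · subst hℓ
      simpa using h h1 h2
    · simp [Function.update_of_ne hℓ]
  simp only [Set.indicator, h1, Pi.one_apply]

/-- The trees attached to the backbone between levels `l` and `l + L`. -/
def treeBlock {n : ℕ} {l L : ℕ} (h : l + L ≤ n) (r : Fin (L + 1)) : Fin (n + 1) :=
  ⟨l + r, by omega⟩

lemma treeBlock_injective {n : ℕ} {l L : ℕ} (h : l + L ≤ n) :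
    (treeBlock h).Injective := fun r r' hr => by
  simp only [treeBlock, Fin.mk.injEq] at hr
  omega

lemma update_treeBlock {n : ℕ} {l L : ℕ} (h : l + L ≤ n) (t : Fin (n + 1) → SpTree d)
    {ℓ : Fin (n + 1)} (hℓ : (ℓ : ℕ) < l ∨ l + L < ℓ) (a : SpTree d) :
    (fun r => Function.update t ℓ a (treeBlock h r)) = fun r => t (treeBlock h r) := by
  funext r
  refine Function.update_of_ne (fun hr => ?_) _ _
  have := congrArg Fin.val hr
  simp only [treeBlock] at this
  omega

lemma endRes_update_treeBlock_le {n : ℕ} {l L : ℕ} (h : l + L ≤ n) (s : Fin L → Site d)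
    (t : Fin (n + 1) → SpTree d) (ℓ : Fin (n + 1)) {a b : SpTree d} (hab : SpTree.Prunes a b) :
    Sample.endRes ((s, fun r => Function.update t ℓ b (treeBlock h r)) : Sample d L) ≤
      Sample.endRes ((s, fun r => Function.update t ℓ a (treeBlock h r)) : Sample d L) := by
  by_cases hℓ : (ℓ : ℕ) < l ∨ l + L < ℓ
  · rw [update_treeBlock h t hℓ, update_treeBlock h t hℓ]
  · obtain ⟨r, rfl⟩ : ∃ r, treeBlock h r = ℓ :=
      ⟨⟨ℓ - l, by omega⟩, Fin.ext (by simp only [treeBlock]; omega)⟩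
    have h1 := Function.update_comp_eq_of_injective t (treeBlock_injective h) r
    have := Sample.endRes_update_le s (t ∘ treeBlock h) r hab
    rw [← h1, ← h1] at this
    exact this

/-- Each alternative, being required for all pairs, makes one of the two functions constant. -/
lemma lintegral_mul_le_of_const {α : Type*} [MeasurableSpace α] [DiscreteMeasurableSpace α]
    (μ : Measure α) [IsProbabilityMeasure μ] {g f : α → ℝ≥0∞}
    (h : (∀ a b, g a = g b) ∨ ∀ a b, f b ≤ f a) :
    ∫⁻ a, g a * f a ∂μ ≤ (∫⁻ a, g a ∂μ) * ∫⁻ a, f a ∂μ := by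
  have : Nonempty α := nonempty_of_isProbabilityMeasure μ
  rcases h with h | h
  · obtain ⟨c, rfl⟩ : ∃ c, g = fun _ => c :=
      ⟨g (Classical.arbitrary _), funext fun _ => h _ _⟩
    rw [lintegral_const_mul _ Measurable.of_discrete]
    simp
  · obtain ⟨c, rfl⟩ : ∃ c, f = fun _ => c :=
      ⟨f (Classical.arbitrary _), funext fun _ => le_antisymm (h _ _) (h _ _)⟩
    rw [lintegral_mul_const _ Measurable.of_discrete]
    simp

lemma lintegral_treeBlock {n m l L : ℕ} (h : l + L ≤ n) {σ : Fin (n + 1) → Measure (SpTree d)}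
    [∀ ℓ, IsProbabilityMeasure (σ ℓ)] (hσ : ∀ r, σ (treeBlock h r) = branchLaw p P m r)
    (F : (Fin (L + 1) → SpTree d) → ℝ≥0∞) :
    ∫⁻ t, F (fun r => t (treeBlock h r)) ∂Measure.pi σ =
      ∫⁻ t, F t ∂(Measure.pi fun r : Fin (L + 1) => branchLaw p P m r) := by
  rw [(measurePreserving_comp_injective (treeBlock_injective h) σ).lintegral_comp
    (Measurable.of_discrete (f := F))]
  simp only [hσ]

lemma lintegral_failTrees_of_indep {n m L i j : ℕ}
    (hρ : ∀ ℓ : Fin (n + 1), IsProbabilityMeasure (branchLaw p P m ℓ))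
    (hj : j * L + L ≤ n) (hij : L = 1 ∨ i < j) (s : Fin L → Site d) :
    ∫⁻ t, (failTrees d n L i).indicator 1 t *
        Sample.endRes ((s, fun r => t (treeBlock hj r)) : Sample d L)
        ∂(Measure.pi fun ℓ : Fin (n + 1) => branchLaw p P m ℓ) ≤
      Measure.pi (fun ℓ : Fin (n + 1) => branchLaw p P m ℓ) (failTrees d n L i) *
        ∫⁻ t, Sample.endRes ((s, t) : Sample d L)
          ∂(Measure.pi fun r : Fin (L + 1) => branchLaw p P (m - j * L) r) := by
  rw [← lintegral_treeBlock (m := m - j * L) hj (σ := fun ℓ : Fin (n + 1) => branchLaw p P m ℓ)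
    (fun r => branchLaw_add m (j * L) r) fun t => Sample.endRes ((s, t) : Sample d L),
    ← lintegral_indicator_one MeasurableSet.of_discrete]
  -- The trees on which the failure may depend. There are none if `L = 1`: the only candidate `ℓ =
  -- i` violates `i + 1/4 ≤ ℓ`, so the failure is certain.
  let rel : Fin (n + 1) → Prop := fun ℓ => L ≠ 1 ∧ i * L ≤ (ℓ : ℕ) ∧ (ℓ : ℕ) < (i + 1) * L
  refine lintegral_pi_mul_le (fun ℓ _ _ => ¬ rel ℓ) (fun ℓ a b => rel ℓ ∨ a = b) _ _ ?_ _ _ ?_ ?_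
  · intro ℓ g f hg hf
    refine lintegral_mul_le_of_const _ ?_
    by_cases h : rel ℓ
    · exact Or.inr fun a b => hf a b (Or.inl h)
    · exact Or.inl fun a b => hg a b h
  · intro ℓ t a b h
    by_cases hL : L = 1
    · subst hL
      simp [failTrees, not_condOne_one]
    · exact indicator_failTrees_update t fun h1 h2 => absurd ⟨hL, h1, h2⟩ h
  · rintro ℓ t a b (⟨hL, h1, h2⟩ | rfl)
    · have h3 : (ℓ : ℕ) < j * L :=
        h2.trans_le (Nat.mul_le_mul_right L (hij.resolve_left hL))
      rw [update_treeBlock hj t (Or.inl h3), update_treeBlock hj t (Or.inl h3)]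
    · exact le_rfl

lemma lintegral_failTrees_of_self (hp : ProgenyAssumptions p) {n m L i : ℕ} (hm : 2 * n ≤ m)
    (hρ : ∀ ℓ : Fin (n + 1), IsProbabilityMeasure (branchLaw p P m ℓ))
    (hi : i * L + L ≤ n) (hL : 2 ≤ L) (s : Fin L → Site d) :
    ∫⁻ t, (failTrees d n L i).indicator 1 t *
        Sample.endRes ((s, fun r => t (treeBlock hi r)) : Sample d L)
        ∂(Measure.pi fun ℓ : Fin (n + 1) => branchLaw p P m ℓ) ≤
      Measure.pi (fun ℓ : Fin (n + 1) => branchLaw p P m ℓ) (failTrees d n L i) *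
        ∫⁻ t, Sample.endRes ((s, t) : Sample d L)
          ∂(Measure.pi fun r : Fin (L + 1) => branchLaw p P (2 * L) r) := by
  classical
  have e1 : (i + 1) * L = i * L + L := by ring
  have e2 : (i + 2) * L = i * L + 2 * L := by ring
  let inside : Fin (n + 1) → Prop := fun ℓ => i * L ≤ (ℓ : ℕ) ∧ (ℓ : ℕ) ≤ i * L + L
  -- The trees of the block are conditioned not to reach level `(i + 2) L`. For `L ≥ 2` this level
  -- is at least two above each of their roots, so the conditioning is not null; for `L = 1` it
  -- could be, at the last vertex.
  let σ : Fin (n + 1) → Measure (SpTree d) := fun ℓ =>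
    if inside ℓ then branchLaw p P ((i + 2) * L) ℓ else branchLaw p P m ℓ
  have hσ : ∀ ℓ, IsProbabilityMeasure (σ ℓ) := by
    intro ℓ
    by_cases h : inside ℓ
    · simp only [σ, if_pos h]
      obtain ⟨h1, h2⟩ := h
      exact branchLaw_prob hp (hρ ℓ) (by omega) (by omega)
    · simp only [σ, if_neg h]
      exact hρ ℓ
  have hσ' : ∀ r, σ (treeBlock hi r) = branchLaw p P (2 * L) r := by
    intro r
    have h : inside (treeBlock hi r) := ⟨by simp [treeBlock], by simp [treeBlock]; omega⟩
    simp only [σ, if_pos h]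
    rw [treeBlock, branchLaw_add, e2, Nat.add_sub_cancel_left]
  rw [← lintegral_treeBlock hi hσ' fun t => Sample.endRes ((s, t) : Sample d L),
    ← lintegral_indicator_one MeasurableSet.of_discrete]
  refine lintegral_pi_mul_le
    (fun ℓ a b => inside ℓ → ((i + 2) * L ≤ (ℓ : ℕ) + a.height ↔ (i + 2) * L ≤ (ℓ : ℕ) + b.height))
    (fun ℓ a b => inside ℓ → SpTree.Prunes a b) _ _ ?_ _ _ ?_ ?_
  · intro ℓ g f hg hf
    by_cases h : inside ℓ
    · simp only [σ, if_pos h]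
      refine branchLaw_mul_le hp (hρ ℓ) ?_ (by omega) (fun a b hab => hg a b fun _ => hab)
        (fun a b hab => hf a b fun _ => hab)
      obtain ⟨h1, h2⟩ := h
      omega
    · simp only [σ, if_neg h]
      have := hρ ℓ
      exact lintegral_mul_le_of_const _ (Or.inl fun a b => hg a b fun h' => absurd h' h)
  · intro ℓ t a b h
    exact indicator_failTrees_update t fun h1 h2 => h ⟨h1, by omega⟩
  · intro ℓ t a b h
    by_cases h' : inside ℓ
    · exact endRes_update_treeBlock_le hi s t ℓ (h h')
    · have h'' : (ℓ : ℕ) < i * L ∨ i * L + L < ℓ := by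
        simp only [inside] at h'
        omega
      rw [update_treeBlock hi t h'', update_treeBlock hi t h'']

lemma exists_lintegral_failTrees_le (hp : ProgenyAssumptions p) {n m L i j : ℕ} (hm : 2 * n ≤ m)
    (hρ : ∀ ℓ : Fin (n + 1), IsProbabilityMeasure (branchLaw p P m ℓ))
    (hL : 1 ≤ L) (hj : j * L + L ≤ n) (hij : i ≤ j) :
    ∃ m', 2 * L ≤ m' ∧ ∀ s : Fin L → Site d,
      ∫⁻ t, (failTrees d n L i).indicator 1 t *
          Sample.endRes ((s, fun r => t (treeBlock hj r)) : Sample d L)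
          ∂(Measure.pi fun ℓ : Fin (n + 1) => branchLaw p P m ℓ) ≤
        Measure.pi (fun ℓ : Fin (n + 1) => branchLaw p P m ℓ) (failTrees d n L i) *
          ∫⁻ t, Sample.endRes ((s, t) : Sample d L)
            ∂(Measure.pi fun r : Fin (L + 1) => branchLaw p P m' r) := by
  -- The level `m'` does not depend on the displacements, so they can be integrated afterwards
  -- against a single `𝒯_{L,m'}`. The bound `m - j L ≥ 2 L` follows from `m ≥ 2 n ≥ 2 (j + 1) L`.
  by_cases h : L = 1 ∨ i < j
  · exact ⟨m - j * L, by omega, lintegral_failTrees_of_indep hρ hj h⟩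
  · obtain rfl : i = j := by omega
    exact ⟨2 * L, le_rfl, lintegral_failTrees_of_self hp hm hρ hj (by omega)⟩

/-- The contribution of one block of the backbone. -/
lemma lintegral_segment_le (hp : ProgenyAssumptions p) {n m L i j : ℕ} (hm : 2 * n ≤ m)
    (hρ : ∀ ℓ : Fin (n + 1), IsProbabilityMeasure (branchLaw p P m ℓ))
    (hL : 1 ≤ L) (hj : j * L + L ≤ n) (hij : i ≤ j) {x : Site d} (hx : 0 < nStep P n 0 x) :
    ∫⁻ ω in failOne d n L i ∩ endpoint n x, (ω.segment (j * L) L hj).endRes ∂(law p P n m) ≤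
      gammaBar p P L x n * law p P n m (failOne d n L i ∩ endpoint n x) := by
  obtain ⟨m', hm', hs⟩ := exists_lintegral_failTrees_le (P := P) (i := i) hp hm hρ hL hj hij
  set τ := Measure.pi fun ℓ : Fin (n + 1) => branchLaw p P m ℓ with hτ
  set A := {s : Fin n → Site d | ∑ r, s r = x} with hA
  have hφ : (fun r : Fin L => (⟨j * L + r, by omega⟩ : Fin n)).Injective := fun r r' hr => by
    simp only [Fin.mk.injEq] at hr
    omega
  have hAx : Measure.pi (fun _ : Fin n => P.toMeasure) A = nStep P n 0 x := by
    rw [← pi_sum_eq_nStep]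
    simp [hA]
  rw [failOne_inter_endpoint, law_eq, ← hA, ← hτ, Measure.prod_prod, hAx,
    ← Measure.prod_restrict, lintegral_prod _ Measurable.of_discrete.aemeasurable]
  calc _ ≤ ∫⁻ s in A, τ (failTrees d n L i) *
          ∫⁻ t, Sample.endRes ((fun r => s ⟨j * L + r, by omega⟩, t) : Sample d L)
            ∂(Measure.pi fun r : Fin (L + 1) => branchLaw p P m' r)
          ∂(Measure.pi fun _ : Fin n => P.toMeasure) := by
        refine lintegral_mono fun s => ?_
        refine le_trans (le_of_eq ?_) (hs fun r => s ⟨j * L + r, by omega⟩)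
        rw [← lintegral_indicator MeasurableSet.of_discrete]
        refine lintegral_congr fun t => ?_
        by_cases ht : t ∈ failTrees d n L i
        · simp only [Set.indicator_of_mem ht, Pi.one_apply, one_mul]
          rfl
        · simp [Set.indicator_of_notMem ht]
    _ = τ (failTrees d n L i) * ∑' y, nStep P (n - L) y x *
          ∫⁻ s in {s : Fin L → Site d | ∑ r, s r = y},
            ∫⁻ t, Sample.endRes ((s, t) : Sample d L)
              ∂(Measure.pi fun r : Fin (L + 1) => branchLaw p P m' r)
            ∂(Measure.pi fun _ : Fin L => P.toMeasure) := by
        rw [lintegral_const_mul _ Measurable.of_discrete]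
        congr 1
        exact lintegral_block P _ hφ x fun s => ∫⁻ t, Sample.endRes ((s, t) : Sample d L)
              ∂(Measure.pi fun r : Fin (L + 1) => branchLaw p P m' r)
    _ ≤ τ (failTrees d n L i) * ∑' y, nStep P (n - L) y x *
          (nStep P L 0 y * gamma p P L y) := by
        gcongr with y
        exact lintegral_endpoint_le L m' hm' y
    _ = _ := by
        rw [gammaBar, mul_comm (nStep P n 0 x), mul_left_comm, ← ENNReal.tsum_mul_right]
        congr 1
        refine tsum_congr fun y => ?_
        rw [mul_right_comm, ENNReal.div_mul_cancel hx.ne' (nStep_ne_top P n 0 x)]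
        ring

lemma law_eq_zero_or (n m : ℕ) :
    law p P n m = 0 ∨ ∀ ℓ : Fin (n + 1), IsProbabilityMeasure (branchLaw p P m ℓ) := by
  by_cases h : ∃ ℓ : Fin (n + 1), branchLaw p P m ℓ = 0
  · obtain ⟨ℓ, hℓ⟩ := h
    left
    have : (Measure.pi fun j : Fin (n + 1) => branchLaw p P m j) = 0 := by
      rw [← Measure.measure_univ_eq_zero, Measure.pi_univ]
      exact Finset.prod_eq_zero (Finset.mem_univ ℓ) (by rw [hℓ]; rfl)
    rw [law_eq, this, Measure.prod_zero]
  · push Not at h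
    right
    intro ℓ
    have h1 := h ℓ
    unfold branchLaw at h1 ⊢
    exact (eq_zero_or_isProbabilityMeasure _).resolve_left h1

end Conditioned

/-! ### Summation over the blocks -/

lemma mul_le_of_le_floor_inv {n L k : ℕ} {δ : ℝ} (hδ : 0 < δ) (hL : (L : ℝ) = δ * n)
    (hk : k ≤ ⌊δ⁻¹⌋₊) : k * L ≤ n := by
  have h1 : (k : ℝ) ≤ δ⁻¹ := (Nat.le_floor_iff (by positivity)).1 hk
  have h2 : (k : ℝ) * L ≤ n := by
    calc (k : ℝ) * L ≤ δ⁻¹ * L := by gcongr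
      _ = n := by rw [hL]; field_simp
  exact_mod_cast h2

end BranchingWalk

theorem lemma4p1 {d : ℕ} (p : PMF ℕ) (hp : BranchingWalk.ProgenyAssumptions p)
    (P : PMF (BranchingWalk.Site d)) (hP : BranchingWalk.StepAssumptions P)
    (n m : ℕ) (hn : 1 ≤ n) (hm : 2 * n ≤ m)
    (δ : ℝ) (hδ : 0 < δ) (L : ℕ) (hL : (L : ℝ) = δ * n)
    (K : ℕ) (hK : 1 ≤ K) (i : ℕ) (hi : i + K ≤ ⌊δ⁻¹⌋₊)
    (x : BranchingWalk.Site d) (hx : 0 < BranchingWalk.nStep P n 0 x) :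
    ∫⁻ ω, BranchingWalk.effRes ω.trace (ω.Phi (i * L)) (ω.Phi ((i + K) * L))
        ∂(ProbabilityTheory.cond (BranchingWalk.law p P n m)
          (BranchingWalk.failOne d n L i ∩ BranchingWalk.endpoint n x))
      ≤ (K : ENNReal) * BranchingWalk.gammaBar p P L x n := by
  open BranchingWalk in
  rcases law_eq_zero_or (p := p) (P := P) n m with h0 | hρ
  · rw [h0, ProbabilityTheory.cond, Measure.restrict_zero, smul_zero, lintegral_zero_measure]
    exact bot_le
  have hL1 : 1 ≤ L := by
    have h1 : (0 : ℝ) < L := by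
      rw [hL]
      have : (0 : ℝ) < n := by exact_mod_cast hn
      positivity
    exact_mod_cast h1
  have hiK := BranchingWalk.mul_le_of_le_floor_inv hδ hL hi
  have hblock : ∀ j ∈ Finset.range K, (i + j) * L + L ≤ n := fun j hj => by
    have hj := Finset.mem_range.1 hj
    calc (i + j) * L + L = (i + j + 1) * L := by ring
      _ ≤ (i + K) * L := Nat.mul_le_mul_right L (by omega)
      _ ≤ n := hiK
  set E := BranchingWalk.failOne d n L i ∩ BranchingWalk.endpoint n x
  rw [ProbabilityTheory.cond, lintegral_smul_measure, smul_eq_mul, mul_comm, ← div_eq_mul_inv]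
  -- This also covers a null conditioning event, where the conditional measure is zero.
  refine ENNReal.div_le_of_le_mul ?_
  calc ∫⁻ ω in E, effRes ω.trace (ω.Phi (i * L)) (ω.Phi ((i + K) * L)) ∂(law p P n m) ≤
      ∫⁻ ω in E, ∑ j ∈ Finset.range K, effRes ω.trace (ω.Phi ((i + j) * L))
        (ω.Phi ((i + j) * L + L)) ∂(law p P n m) := by
        refine lintegral_mono fun ω => ?_
        have h1 := effRes_le_sum ω.trace (fun j => ω.Phi ((i + j) * L)) K
        simpa only [add_zero, ← add_assoc, add_mul, one_mul] using h1
    _ = ∑ j ∈ Finset.range K, ∫⁻ ω in E, effRes ω.trace (ω.Phi ((i + j) * L))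
        (ω.Phi ((i + j) * L + L)) ∂(law p P n m) :=
        lintegral_finsetSum _ fun _ _ => Measurable.of_discrete
    _ ≤ ∑ j ∈ Finset.range K, gammaBar p P L x n * law p P n m E := by
        refine Finset.sum_le_sum fun j hj => ?_
        refine le_trans (lintegral_mono fun ω =>
          Sample.effRes_le_endRes_segment ω (hblock j hj)) ?_
        exact lintegral_segment_le hp hm hρ hL1 (hblock j hj) (Nat.le_add_right i j) hx
    _ = _ := by
        rw [Finset.sum_const, Finset.card_range, nsmul_eq_mul, mul_assoc]
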